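/- Let $n\ge 2$ and let $\mathcal{K}_o^n$ be the set of compact convex subsets of $\mathbb{R}^n$ containing the origin in their interiors. For $K\in\mathcal{K}_o^n$ let $h_K(u)=\sup_{x\in K}\langle u,x\rangle$ be its support function and let $S(K,\cdot)$ be its surface area measure on the unit sphere $S^{n-1}$, that is, $S(K,E)=\mathcal{H}^{n-1}(\nu_K^{-1}(E))$ for Borel sets $E\subset S^{n-1}$, where $\nu_K$ is the Gauss map, which assigns to each boundary point of $K$ with a unique outer unit normal vector that vector. Let $\mathcal{I}$ be the class of continuous, strictly increasing functions $\varphi:(0,\infty)\to(0,\infty)$ with $\varphi(1)=1$, $\lim_{t\to0^+}\varphi(t)=0$ and $\lim_{t\to\infty}\varphi(t)=\infty$. For $K,M\in\mathcal{K}_o^n$ and $\varphi\in\mathcal{I}$, the Orlicz mixed volume is $$V_\varphi(K,M)=\frac1n\int_{S^{n-1}}\varphi\!\left(\frac{h_M(u)}{h_K(u)}\right)h_K(u)\,dS(K,u).$$ We say that $\varphi$ behaves like $t^n$ if there is $r>0$, $r\ne1$, such that $\varphi(rt)=r^n\varphi(t)$ for all $t>0$. Let $K,L\in\mathcal{K}_o^n$.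 Suppose that $\varphi\in\mathcal{I}$ is strictly convex and that $V_\varphi(K,M)=V_\varphi(L,M)$ for all $M\in\mathcal{K}_o^n$. Then $K$ and $L$ are dilatates of each other, i.e. $L=rK$ for some $r>0$. Moreover, $K=L$ unless $\varphi$ behaves like $t^n$. -/

import Mathlib

open MeasureTheory Set Filter Topology
open scoped Pointwise

namespace OrliczMixed

variable {n : ℕ}

/-- The support function `h_K(u) = sup_{x ∈ K} ⟨u, x⟩`. -/
noncomputable def supportFun (K : Set (EuclideanSpace ℝ (Fin n)))
    (u : EuclideanSpace ℝ (Fin n)) : ℝ :=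
  sSup ((fun x => inner ℝ u x) '' K)

/-- `u` is an outer unit normal vector of `K` at `x`, that is, `x` lies in the supporting
hyperplane `H(K, u) = {x : ⟨x, u⟩ = h_K(u)}`. -/
def IsOuterNormal (K : Set (EuclideanSpace ℝ (Fin n))) (x : EuclideanSpace ℝ (Fin n))
    (u : Metric.sphere (0 : EuclideanSpace ℝ (Fin n)) 1) : Prop :=
  inner ℝ x (u : EuclideanSpace ℝ (Fin n)) = supportFun K u

/-- `reg K`: the boundary points of `K` that have exactly one outer unit normal vector. -/
def regularBoundary (K : Set (EuclideanSpace ℝ (Fin n))) : Set (EuclideanSpace ℝ (Fin n)) :=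
  {x | x ∈ frontier K ∧ ∃! u, IsOuterNormal K x u}

/-- The Gauss map `ν_K`: the outer unit normal vector at a regular boundary point. -/
noncomputable def gaussMap (K : Set (EuclideanSpace ℝ (Fin n))) (x : regularBoundary K) :
    Metric.sphere (0 : EuclideanSpace ℝ (Fin n)) 1 :=
  x.2.2.choose

/-- The surface area measure `S(K, ·)` on the unit sphere: `S(K, E) = H^{n-1}(ν_K⁻¹(E))`, see
`surfaceAreaMeasure_apply`. The measure `H^{n-1}` is the Hausdorff measure in its Euclidean
normalization, restricted here to the set of regular boundary points. -/
noncomputable def surfaceAreaMeasure (K : Set (EuclideanSpace ℝ (Fin n))) :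
    Measure (Metric.sphere (0 : EuclideanSpace ℝ (Fin n)) 1) :=
  ((μHE[n - 1] : Measure (EuclideanSpace ℝ (Fin n))).comap
    (Subtype.val : regularBoundary K → EuclideanSpace ℝ (Fin n))).map (gaussMap K)

/-- The Orlicz mixed volume
`V_φ(K, L) = (1/n) ∫ φ(h_L(u) / h_K(u)) h_K(u) dS(K, u)` over the unit sphere. -/
noncomputable def orliczMixedVolume (φ : ℝ → ℝ) (K L : Set (EuclideanSpace ℝ (Fin n))) : ℝ :=
  (1 / (n : ℝ)) * ∫ u : Metric.sphere (0 : EuclideanSpace ℝ (Fin n)) 1,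
    φ (supportFun L u / supportFun K u) * supportFun K u ∂(surfaceAreaMeasure K)

/-- `L` is a dilatate of `K`: `L = r K` for some `r > 0`. -/
def IsDilatate (K L : Set (EuclideanSpace ℝ (Fin n))) : Prop :=
  ∃ r : ℝ, 0 < r ∧ L = r • K

/-- The class `𝓘` of continuous, strictly increasing functions `φ : (0, ∞) → (0, ∞)` with
`φ(1) = 1`, `φ(0+) = 0` and `φ(∞) = ∞`. Only the values on `(0, ∞)` matter. -/
structure ClassI (φ : ℝ → ℝ) : Prop where
  pos : ∀ t, 0 < t → 0 < φ t
  continuousOn : ContinuousOn φ (Ioi 0)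
  strictMonoOn : StrictMonoOn φ (Ioi 0)
  map_one : φ 1 = 1
  tendsto_zero : Tendsto φ (𝓝[>] 0) (𝓝 0)
  tendsto_atTop : Tendsto φ atTop atTop

/-- `φ` behaves like `t ^ n`: for some `r > 0`, `r ≠ 1`, one has `φ(r t) = r ^ n φ(t)` for all
`t > 0`. -/
def BehavesLikePow (n : ℕ) (φ : ℝ → ℝ) : Prop :=
  ∃ r : ℝ, 0 < r ∧ r ≠ 1 ∧ ∀ t : ℝ, 0 < t → φ (r * t) = r ^ n * φ t

/-! The following facts show that `surfaceAreaMeasure` is given by the formula in its docstring. -/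

theorem isOuterNormal_gaussMap (K : Set (EuclideanSpace ℝ (Fin n))) (x : regularBoundary K) :
    IsOuterNormal K x (gaussMap K x) :=
  x.2.2.choose_spec.1

theorem isOuterNormal_iff (K : ConvexBody (EuclideanSpace ℝ (Fin n)))
    {x : EuclideanSpace ℝ (Fin n)} (hx : x ∈ frontier (K : Set (EuclideanSpace ℝ (Fin n))))
    (u : Metric.sphere (0 : EuclideanSpace ℝ (Fin n)) 1) :
    IsOuterNormal (K : Set (EuclideanSpace ℝ (Fin n))) x u ↔
      ∀ y ∈ (K : Set (EuclideanSpace ℝ (Fin n))),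
        inner ℝ (u : EuclideanSpace ℝ (Fin n)) y ≤ inner ℝ (u : EuclideanSpace ℝ (Fin n)) x := by
  have hxK : x ∈ (K : Set (EuclideanSpace ℝ (Fin n))) := K.isClosed.frontier_subset hx
  have hbdd : BddAbove ((fun y => inner ℝ (u : EuclideanSpace ℝ (Fin n)) y) ''
      (K : Set (EuclideanSpace ℝ (Fin n)))) :=
    (K.isCompact.image (by fun_prop)).bddAbove
  unfold IsOuterNormal supportFun
  rw [real_inner_comm]
  constructor
  · intro h y hy
    rw [h]
    exact le_csSup hbdd ⟨y, hy, rfl⟩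
  · intro h
    refine le_antisymm (le_csSup hbdd ⟨x, hxK, rfl⟩) (csSup_le ⟨_, x, hxK, rfl⟩ ?_)
    rintro _ ⟨y, hy, rfl⟩
    exact h y hy

/-- The set of pairs of a boundary point and an outer normal vector there is closed. -/
theorem isClosed_normalBundle (K : ConvexBody (EuclideanSpace ℝ (Fin n))) :
    IsClosed {p : EuclideanSpace ℝ (Fin n) × Metric.sphere (0 : EuclideanSpace ℝ (Fin n)) 1 |
      p.1 ∈ frontier (K : Set (EuclideanSpace ℝ (Fin n))) ∧
        IsOuterNormal (K : Set (EuclideanSpace ℝ (Fin n))) p.1 p.2} := by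
  have : {p : EuclideanSpace ℝ (Fin n) × Metric.sphere (0 : EuclideanSpace ℝ (Fin n)) 1 |
      p.1 ∈ frontier (K : Set (EuclideanSpace ℝ (Fin n))) ∧
        IsOuterNormal (K : Set (EuclideanSpace ℝ (Fin n))) p.1 p.2} =
      (Prod.fst ⁻¹' frontier (K : Set (EuclideanSpace ℝ (Fin n)))) ∩
      ⋂ y ∈ (K : Set (EuclideanSpace ℝ (Fin n))),
        {p : EuclideanSpace ℝ (Fin n) × Metric.sphere (0 : EuclideanSpace ℝ (Fin n)) 1 |
          inner ℝ (p.2 : EuclideanSpace ℝ (Fin n)) y ≤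
          inner ℝ (p.2 : EuclideanSpace ℝ (Fin n)) p.1} := by
    ext p
    simp only [mem_ofPred_eq, mem_inter_iff, mem_preimage, mem_iInter]
    exact and_congr_right fun h => isOuterNormal_iff K h p.2
  rw [this]
  refine (isClosed_frontier.preimage continuous_fst).inter
    (isClosed_biInter fun y _ => isClosed_le ?_ ?_) <;> fun_prop

theorem measurableSet_regularBoundary (K : ConvexBody (EuclideanSpace ℝ (Fin n))) :
    MeasurableSet (regularBoundary (K : Set (EuclideanSpace ℝ (Fin n)))) := by
  set N := {p : EuclideanSpace ℝ (Fin n) × Metric.sphere (0 : EuclideanSpace ℝ (Fin n)) 1 |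
      p.1 ∈ frontier (K : Set (EuclideanSpace ℝ (Fin n))) ∧
        IsOuterNormal (K : Set (EuclideanSpace ℝ (Fin n))) p.1 p.2} with hN
  have hNc : IsClosed N := isClosed_normalBundle K
  let F : ℕ → Set (EuclideanSpace ℝ (Fin n) × (Metric.sphere (0 : EuclideanSpace ℝ (Fin n)) 1 ×
      Metric.sphere (0 : EuclideanSpace ℝ (Fin n)) 1)) := fun m =>
    {q | (q.1, q.2.1) ∈ N ∧ (q.1, q.2.2) ∈ N ∧ 1 / ((m : ℝ) + 1) ≤ dist q.2.1 q.2.2}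
  have hF : ∀ m, IsClosed (F m) := fun m =>
    (hNc.preimage (f := fun q : EuclideanSpace ℝ (Fin n) ×
      (Metric.sphere (0 : EuclideanSpace ℝ (Fin n)) 1 ×
      Metric.sphere (0 : EuclideanSpace ℝ (Fin n)) 1) => (q.1, q.2.1)) (by fun_prop)).inter
    ((hNc.preimage (f := fun q : EuclideanSpace ℝ (Fin n) ×
      (Metric.sphere (0 : EuclideanSpace ℝ (Fin n)) 1 ×
      Metric.sphere (0 : EuclideanSpace ℝ (Fin n)) 1) => (q.1, q.2.2)) (by fun_prop)).inter
    (isClosed_le (f := fun _ => 1 / ((m : ℝ) + 1))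
      (g := fun q : EuclideanSpace ℝ (Fin n) ×
        (Metric.sphere (0 : EuclideanSpace ℝ (Fin n)) 1 ×
        Metric.sphere (0 : EuclideanSpace ℝ (Fin n)) 1) => dist q.2.1 q.2.2)
      (by fun_prop) (by fun_prop)))
  have hreg : regularBoundary (K : Set (EuclideanSpace ℝ (Fin n))) =
      (Prod.fst '' N) \ ⋃ m, Prod.fst '' F m := by
    ext x
    constructor
    · rintro ⟨hx, u, hu, huniq⟩
      refine ⟨⟨(x, u), ⟨hx, hu⟩, rfl⟩, ?_⟩
      simp only [mem_iUnion, not_exists]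
      rintro m ⟨⟨y, v, w⟩, ⟨hv, hw, hd⟩, rfl⟩
      rw [huniq v hv.2, huniq w hw.2, dist_self] at hd
      exact absurd hd (not_le.2 (by positivity))
    · rintro ⟨⟨⟨y, u⟩, hu, rfl⟩, hno⟩
      refine ⟨hu.1, u, hu.2, fun v hv => ?_⟩
      by_contra hvu
      obtain ⟨m, hm⟩ := exists_nat_one_div_lt (dist_pos.2 hvu)
      exact hno (mem_iUnion.2 ⟨m, (y, v, u), ⟨⟨hu.1, hv⟩, hu, hm.le⟩, rfl⟩)
  rw [hreg]
  exact (isClosedMap_fst_of_compactSpace _ hNc).measurableSet.diff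
    (MeasurableSet.iUnion fun m => (isClosedMap_fst_of_compactSpace _ (hF m)).measurableSet)

theorem continuous_gaussMap (K : ConvexBody (EuclideanSpace ℝ (Fin n))) :
    Continuous (gaussMap (K : Set (EuclideanSpace ℝ (Fin n)))) := by
  rw [continuous_iff_isClosed]
  intro C hC
  have h := isClosedMap_fst_of_compactSpace _
    ((isClosed_normalBundle K).inter (hC.preimage continuous_snd))
  convert h.preimage continuous_subtype_val using 1
  ext x
  constructor
  · intro hx
    exact ⟨(x, gaussMap _ x), ⟨⟨x.2.1, isOuterNormal_gaussMap _ x⟩, hx⟩, rfl⟩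
  · rintro ⟨⟨y, u⟩, ⟨⟨_, hu⟩, huC⟩, hy⟩
    have hy' : y = x := hy
    subst hy'
    have : gaussMap (K : Set (EuclideanSpace ℝ (Fin n))) x = u :=
      x.2.2.unique (isOuterNormal_gaussMap _ x) hu
    rw [mem_preimage, this]
    exact huC

theorem surfaceAreaMeasure_apply (K : ConvexBody (EuclideanSpace ℝ (Fin n)))
    {B : Set (Metric.sphere (0 : EuclideanSpace ℝ (Fin n)) 1)} (hB : MeasurableSet B) :
    surfaceAreaMeasure (K : Set (EuclideanSpace ℝ (Fin n))) B =
      μHE[n - 1] (Subtype.val '' (gaussMap (K : Set (EuclideanSpace ℝ (Fin n))) ⁻¹' B)) := by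
  have hm := (continuous_gaussMap K).measurable
  rw [surfaceAreaMeasure, Measure.map_apply hm hB]
  exact (MeasurableEmbedding.subtype_coe (measurableSet_regularBoundary K)).comap_apply _ _

end OrliczMixed

namespace OrliczMixed

/-! ### Support function, gauge, and the gradient of the gauge. -/

section ConvexGeometry

variable {n : ℕ} {K M : ConvexBody (EuclideanSpace ℝ (Fin n))}

/-! Write `g` for the gauge of `K`. At almost every `z` it is differentiable, and its gradient is `u
/ h_K(u)`, where `u` is the outer normal at the radial projection of `z` to the boundary
(`polarPoint_eq_gradient`). The measure `h_K dS(K, ·)`, carried to these polar points, is `n` times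
the image of Lebesgue measure on `K` under the gradient (`polarSurfaceMeasure_eq`): this is the
formula "height times base over `n`" for cones, made exact by flattening small pieces of the
boundary. Hence `V_φ(K, M)` is the integral of `φ(h_M(∇g))` over `K`, and surface area disappears
from the problem.

Let `K` and `M` have volumes `a ^ n` and `b ^ n`. Brunn-Minkowski, obtained from Prékopa-Leindler,
and a first-order upper bound for the volume of `K + tM` show that the mean of `h_M(∇g)` over `K` is
at least `b / a` (`minkowski_first_inequality`). Jensen's inequality then gives `V_φ(K, M) ≥ φ(b /
a) a ^ n`. In the equality case strict convexity makes `h_M(∇g)` almost everywhere equal to `b / a`;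
this forces `M ⊆ (b / a) K`, and equal volumes turn the inclusion into an equality
(`orlicz_minkowski_inequality`). The equality case of Brunn-Minkowski is not needed.

Finally let `K` and `L` have volumes `k ^ n` and `l ^ n`. Testing with `M = cK`, and with the dilate
of `L` of the same volume, gives two opposite inequalities, so `φ(c) k ^ n = φ(ck / l) l ^ n` for
all `c > 0`. The equality case at `c = 1` yields `K = (k / l) L`, and for `k ≠ l` the identity says
that `φ` behaves like `t ^ n` with `r = k / l`. -/

theorem inner_le_supportFun (K : ConvexBody (EuclideanSpace ℝ (Fin n)))
    {x : EuclideanSpace ℝ (Fin n)} (hx : x ∈ (K : Set _)) (u : EuclideanSpace ℝ (Fin n)) :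
    inner ℝ u x ≤ supportFun (K : Set _) u :=
  le_csSup (K.isCompact.image (f := fun y => inner ℝ u y) (by fun_prop)).bddAbove ⟨x, hx, rfl⟩

theorem supportFun_le (K : ConvexBody (EuclideanSpace ℝ (Fin n)))
    {u : EuclideanSpace ℝ (Fin n)} {c : ℝ} (h : ∀ x ∈ (K : Set _), inner ℝ u x ≤ c) :
    supportFun (K : Set _) u ≤ c := by
  refine csSup_le (K.nonempty.image _) ?_
  rintro _ ⟨x, hx, rfl⟩
  exact h x hx

theorem exists_inner_eq_supportFun (K : ConvexBody (EuclideanSpace ℝ (Fin n)))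
    (u : EuclideanSpace ℝ (Fin n)) : ∃ x ∈ (K : Set _), inner ℝ u x = supportFun (K : Set _) u := by
  obtain ⟨x, hx, h⟩ := K.isCompact.exists_isMaxOn K.nonempty
    (f := fun y => inner ℝ u y) (by fun_prop)
  exact ⟨x, hx, le_antisymm (inner_le_supportFun K hx u) (supportFun_le K fun y hy => h hy)⟩

theorem supportFun_smul (K : ConvexBody (EuclideanSpace ℝ (Fin n))) {c : ℝ} (hc : 0 ≤ c)
    (u : EuclideanSpace ℝ (Fin n)) :
    supportFun (K : Set _) (c • u) = c * supportFun (K : Set _) u := by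
  obtain ⟨x, hx, h⟩ := exists_inner_eq_supportFun K u
  refine le_antisymm (supportFun_le K fun y hy => ?_) ?_
  · rw [real_inner_smul_left]
    exact mul_le_mul_of_nonneg_left (inner_le_supportFun K hy u) hc
  · rw [← h, ← real_inner_smul_left]
    exact inner_le_supportFun K hx _

theorem supportFun_le_add (K : ConvexBody (EuclideanSpace ℝ (Fin n))) {R : ℝ}
    (hR : (K : Set (EuclideanSpace ℝ (Fin n))) ⊆ Metric.closedBall 0 R) (u w : EuclideanSpace ℝ (Fin n)) :
    supportFun (K : Set _) u ≤ supportFun (K : Set _) w + R * ‖u - w‖ := by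
  refine supportFun_le K fun x hx => ?_
  have h1 := inner_le_supportFun K hx w
  have h2 := real_inner_le_norm (u - w) x
  have h3 : ‖x‖ ≤ R := by simpa using hR hx
  have h4 := mul_le_mul_of_nonneg_left h3 (norm_nonneg (u - w))
  rw [inner_sub_left] at h2
  linarith

theorem exists_subset_closedBall (K : ConvexBody (EuclideanSpace ℝ (Fin n))) :
    ∃ R : ℝ, 0 < R ∧ (K : Set (EuclideanSpace ℝ (Fin n))) ⊆ Metric.closedBall 0 R := by
  obtain ⟨R, h⟩ := K.isBounded.subset_closedBall 0
  exact ⟨max R 1, by positivity, h.trans (Metric.closedBall_subset_closedBall (le_max_left _ _))⟩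

theorem continuous_supportFun (K : ConvexBody (EuclideanSpace ℝ (Fin n))) :
    Continuous (supportFun (K : Set (EuclideanSpace ℝ (Fin n)))) := by
  obtain ⟨R, hR, h⟩ := exists_subset_closedBall K
  refine (LipschitzWith.of_le_add_mul' R fun u w => ?_).continuous
  rw [dist_eq_norm]
  exact supportFun_le_add K h u w

theorem supportFun_zero (K : ConvexBody (EuclideanSpace ℝ (Fin n))) :
    supportFun (K : Set (EuclideanSpace ℝ (Fin n))) 0 = 0 := by
  simpa using supportFun_smul K (le_refl (0 : ℝ)) 0

theorem supportFun_le_norm (K : ConvexBody (EuclideanSpace ℝ (Fin n))) {R : ℝ}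
    (hR : (K : Set (EuclideanSpace ℝ (Fin n))) ⊆ Metric.closedBall 0 R) (u : EuclideanSpace ℝ (Fin n)) :
    supportFun (K : Set _) u ≤ R * ‖u‖ := by
  simpa [supportFun_zero] using supportFun_le_add K hR u 0

theorem exists_norm_le_supportFun
    (hK : (0 : EuclideanSpace ℝ (Fin n)) ∈ interior (K : Set (EuclideanSpace ℝ (Fin n)))) :
    ∃ r : ℝ, 0 < r ∧ ∀ u, r * ‖u‖ ≤ supportFun (K : Set (EuclideanSpace ℝ (Fin n))) u := by
  obtain ⟨r, hr, h⟩ := Metric.nhds_basis_closedBall.mem_iff.1 (mem_interior_iff_mem_nhds.1 hK)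
  refine ⟨r, hr, fun u => ?_⟩
  rcases eq_or_ne u 0 with rfl | hu
  · simp [supportFun_zero]
  have hu' : 0 < ‖u‖ := norm_pos_iff.2 hu
  have := inner_le_supportFun K (x := (r / ‖u‖) • u) (h ?_) u
  · rw [real_inner_smul_right, real_inner_self_eq_norm_sq] at this
    convert this using 1
    field_simp
  · simp [norm_smul, abs_of_pos hr, hu'.ne']

theorem supportFun_pos
    (hK : (0 : EuclideanSpace ℝ (Fin n)) ∈ interior (K : Set (EuclideanSpace ℝ (Fin n))))
    {u : EuclideanSpace ℝ (Fin n)} (hu : u ≠ 0) : 0 < supportFun (K : Set _) u := by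
  obtain ⟨r, hr, h⟩ := exists_norm_le_supportFun hK
  exact (mul_pos hr (norm_pos_iff.2 hu)).trans_le (h u)

theorem supportFun_nonneg
    (hK : (0 : EuclideanSpace ℝ (Fin n)) ∈ interior (K : Set (EuclideanSpace ℝ (Fin n))))
    (u : EuclideanSpace ℝ (Fin n)) : 0 ≤ supportFun (K : Set _) u := by
  obtain ⟨r, hr, h⟩ := exists_norm_le_supportFun hK
  exact le_trans (by positivity) (h u)

theorem supportFun_smul_set (K : ConvexBody (EuclideanSpace ℝ (Fin n))) {c : ℝ} (hc : 0 ≤ c)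
    (u : EuclideanSpace ℝ (Fin n)) :
    supportFun (c • (K : Set (EuclideanSpace ℝ (Fin n)))) u = c * supportFun (K : Set _) u := by
  rw [← supportFun_smul K hc, supportFun, supportFun, ← image_smul, image_image]
  simp only [real_inner_smul_left, real_inner_smul_right]

theorem gauge_le_one_iff
    (hK : (0 : EuclideanSpace ℝ (Fin n)) ∈ interior (K : Set (EuclideanSpace ℝ (Fin n))))
    {x : EuclideanSpace ℝ (Fin n)} : gauge (K : Set _) x ≤ 1 ↔ x ∈ (K : Set _) := by
  rw [gauge_le_one_iff_mem_closure K.convex (mem_interior_iff_mem_nhds.1 hK),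
    K.isClosed.closure_eq]

theorem gauge_smul_eq (K : ConvexBody (EuclideanSpace ℝ (Fin n))) {c : ℝ} (hc : 0 ≤ c)
    (x : EuclideanSpace ℝ (Fin n)) :
    gauge (K : Set _) (c • x) = c * gauge (K : Set _) x := by
  rw [gauge_smul_of_nonneg hc, smul_eq_mul]

theorem gauge_pos_iff
    (hK : (0 : EuclideanSpace ℝ (Fin n)) ∈ interior (K : Set (EuclideanSpace ℝ (Fin n))))
    {x : EuclideanSpace ℝ (Fin n)} : 0 < gauge (K : Set _) x ↔ x ≠ 0 :=
  gauge_pos (absorbent_nhds_zero (mem_interior_iff_mem_nhds.1 hK))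
    ((NormedSpace.isVonNBounded_iff ℝ).2 K.isBounded)

theorem gauge_eq_one_iff
    (hK : (0 : EuclideanSpace ℝ (Fin n)) ∈ interior (K : Set (EuclideanSpace ℝ (Fin n))))
    {x : EuclideanSpace ℝ (Fin n)} : gauge (K : Set _) x = 1 ↔ x ∈ frontier (K : Set _) :=
  gauge_eq_one_iff_mem_frontier K.convex (mem_interior_iff_mem_nhds.1 hK)

theorem gauge_inv_smul
    (hK : (0 : EuclideanSpace ℝ (Fin n)) ∈ interior (K : Set (EuclideanSpace ℝ (Fin n))))
    {x : EuclideanSpace ℝ (Fin n)} (hx : x ≠ 0) :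
    gauge (K : Set _) ((gauge (K : Set _) x)⁻¹ • x) = 1 := by
  have := (gauge_pos_iff hK).2 hx
  rw [gauge_smul_eq K (by positivity), inv_mul_cancel₀ this.ne']

theorem inner_le_supportFun_mul_gauge
    (hK : (0 : EuclideanSpace ℝ (Fin n)) ∈ interior (K : Set (EuclideanSpace ℝ (Fin n))))
    (u x : EuclideanSpace ℝ (Fin n)) :
    inner ℝ u x ≤ supportFun (K : Set _) u * gauge (K : Set _) x := by
  rcases eq_or_ne x 0 with rfl | hx
  · simp
  have h0 := (gauge_pos_iff hK).2 hx
  have h := inner_le_supportFun K ((gauge_le_one_iff hK).1 (gauge_inv_smul hK hx).le) u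
  rw [real_inner_smul_right, inv_mul_le_iff₀ h0] at h
  linarith

theorem continuous_gauge_body
    (hK : (0 : EuclideanSpace ℝ (Fin n)) ∈ interior (K : Set (EuclideanSpace ℝ (Fin n)))) :
    Continuous (gauge (K : Set (EuclideanSpace ℝ (Fin n)))) :=
  continuous_gauge K.convex (mem_interior_iff_mem_nhds.1 hK)

/-- The point of the boundary of the polar body in direction `u`. -/
noncomputable def polarPoint (K : Set (EuclideanSpace ℝ (Fin n))) (u : EuclideanSpace ℝ (Fin n)) :
    EuclideanSpace ℝ (Fin n) :=
  (supportFun K u)⁻¹ • u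

theorem supportFun_polarPoint
    (hK : (0 : EuclideanSpace ℝ (Fin n)) ∈ interior (K : Set (EuclideanSpace ℝ (Fin n))))
    (u : EuclideanSpace ℝ (Fin n)) :
    supportFun (M : Set _) (polarPoint (K : Set _) u) =
      supportFun (M : Set _) u / supportFun (K : Set _) u := by
  rw [polarPoint, supportFun_smul M (inv_nonneg.2 (supportFun_nonneg hK u)), div_eq_inv_mul]

theorem inner_polarPoint_le_gauge
    (hK : (0 : EuclideanSpace ℝ (Fin n)) ∈ interior (K : Set (EuclideanSpace ℝ (Fin n))))
    {u : EuclideanSpace ℝ (Fin n)} (hu : u ≠ 0) (x : EuclideanSpace ℝ (Fin n)) :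
    inner ℝ (polarPoint (K : Set _) u) x ≤ gauge (K : Set _) x := by
  rw [polarPoint, real_inner_smul_left, inv_mul_le_iff₀ (supportFun_pos hK hu)]
  exact inner_le_supportFun_mul_gauge hK u x

theorem sphere_coe_ne_zero (u : Metric.sphere (0 : EuclideanSpace ℝ (Fin n)) 1) :
    (u : EuclideanSpace ℝ (Fin n)) ≠ 0 := by
  have := norm_eq_of_mem_sphere u
  intro h
  simp [h] at this

theorem norm_polarPoint
    (hK : (0 : EuclideanSpace ℝ (Fin n)) ∈ interior (K : Set (EuclideanSpace ℝ (Fin n))))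
    (u : Metric.sphere (0 : EuclideanSpace ℝ (Fin n)) 1) :
    ‖polarPoint (K : Set _) (u : EuclideanSpace ℝ (Fin n))‖ = (supportFun (K : Set _) (u : EuclideanSpace ℝ (Fin n)))⁻¹ := by
  rw [polarPoint, norm_smul, norm_eq_of_mem_sphere u, mul_one, Real.norm_eq_abs,
    abs_of_nonneg (inv_nonneg.2 (supportFun_nonneg hK _))]

/-- The norm of the polar point is `1 / h_K(u)`, so the point determines `h_K(u)` and then `u`. -/
theorem polarPoint_injective
    (hK : (0 : EuclideanSpace ℝ (Fin n)) ∈ interior (K : Set (EuclideanSpace ℝ (Fin n)))) :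
    Function.Injective fun u : Metric.sphere (0 : EuclideanSpace ℝ (Fin n)) 1 =>
      polarPoint (K : Set _) (u : EuclideanSpace ℝ (Fin n)) := by
  intro u w h
  simp only at h
  have hn : supportFun (K : Set _) (u : EuclideanSpace ℝ (Fin n)) =
      supportFun (K : Set _) (w : EuclideanSpace ℝ (Fin n)) := by
    rw [← inv_inj, ← norm_polarPoint hK, ← norm_polarPoint hK, h]
  rw [polarPoint, polarPoint, hn] at h
  exact Subtype.ext (smul_right_injective _
    (inv_ne_zero (supportFun_pos hK (sphere_coe_ne_zero w)).ne') h)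

theorem continuous_polarPoint
    (hK : (0 : EuclideanSpace ℝ (Fin n)) ∈ interior (K : Set (EuclideanSpace ℝ (Fin n)))) :
    Continuous fun u : Metric.sphere (0 : EuclideanSpace ℝ (Fin n)) 1 =>
      polarPoint (K : Set _) (u : EuclideanSpace ℝ (Fin n)) :=
  (((continuous_supportFun K).comp continuous_subtype_val).inv₀ fun u =>
    (supportFun_pos hK (sphere_coe_ne_zero u)).ne').smul continuous_subtype_val

theorem isOuterNormal_iff_inner_polarPoint
    (hK : (0 : EuclideanSpace ℝ (Fin n)) ∈ interior (K : Set (EuclideanSpace ℝ (Fin n))))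
    (x : EuclideanSpace ℝ (Fin n)) (u : Metric.sphere (0 : EuclideanSpace ℝ (Fin n)) 1) :
    IsOuterNormal (K : Set _) x u ↔
      inner ℝ (polarPoint (K : Set _) (u : EuclideanSpace ℝ (Fin n))) x = 1 := by
  have := supportFun_pos hK (sphere_coe_ne_zero u)
  rw [IsOuterNormal, polarPoint, real_inner_smul_left, real_inner_comm,
    inv_mul_eq_one₀ this.ne', eq_comm]

/-- Hahn-Banach separates the boundary point from the open interior; the inequality extends to `K`,
the closure of its interior, and the functional is normalized. -/
theorem exists_isOuterNormal
    (hK : (0 : EuclideanSpace ℝ (Fin n)) ∈ interior (K : Set (EuclideanSpace ℝ (Fin n))))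
    {x : EuclideanSpace ℝ (Fin n)} (hx : x ∈ frontier (K : Set _)) :
    ∃ u, IsOuterNormal (K : Set _) x u := by
  obtain ⟨f, hf⟩ := geometric_hahn_banach_open_point K.convex.interior isOpen_interior hx.2
  obtain ⟨v, rfl⟩ := (InnerProductSpace.toDual ℝ _).surjective f
  simp only [InnerProductSpace.toDual_apply_apply] at hf
  have hv : v ≠ 0 := by
    rintro rfl
    simpa using hf 0 hK
  have hle : ∀ y ∈ (K : Set (EuclideanSpace ℝ (Fin n))), inner ℝ v y ≤ inner ℝ v x := by
    have hc : IsClosed {y : EuclideanSpace ℝ (Fin n) | inner ℝ v y ≤ inner ℝ v x} :=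
      isClosed_le (by fun_prop) (by fun_prop)
    have h1 : closure (interior (K : Set (EuclideanSpace ℝ (Fin n)))) ⊆ _ :=
      hc.closure_subset_iff.2 fun y hy => (hf y hy).le
    rw [K.convex.closure_interior_eq_closure_of_nonempty_interior ⟨0, hK⟩,
      K.isClosed.closure_eq] at h1
    exact h1
  have hv' : 0 < ‖v‖ := norm_pos_iff.2 hv
  refine ⟨⟨‖v‖⁻¹ • v, by simp [norm_smul, hv'.ne']⟩, (isOuterNormal_iff K hx _).2 fun y hy => ?_⟩
  simp only [real_inner_smul_left]
  exact mul_le_mul_of_nonneg_left (hle y hy) (by positivity)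

/-- At a point where the gauge is differentiable, every subgradient equals the gradient. -/
theorem eq_gradient_of_subgradient {f : EuclideanSpace ℝ (Fin n) → ℝ}
    {z q : EuclideanSpace ℝ (Fin n)} (hf : DifferentiableAt ℝ f z)
    (hq : ∀ w, inner ℝ q (w - z) ≤ f w - f z) : q = gradient f z := by
  have hmin : IsLocalMin (fun w => f w - inner ℝ q w) z := by
    refine Eventually.of_forall fun w => ?_
    have := hq w
    rw [inner_sub_right] at this
    simp only
    linarith
  have hd : HasFDerivAt (fun w => f w - inner ℝ q w)
      (fderiv ℝ f z - InnerProductSpace.toDual ℝ _ q) z :=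
    hf.hasFDerivAt.sub (InnerProductSpace.toDual ℝ _ q).hasFDerivAt
  have h0 := sub_eq_zero.1 (hmin.hasFDerivAt_eq_zero hd)
  rw [gradient, h0, LinearIsometryEquiv.symm_apply_apply]

theorem measurable_gradient (f : EuclideanSpace ℝ (Fin n) → ℝ) : Measurable (gradient f) :=
  (InnerProductSpace.toDual ℝ (EuclideanSpace ℝ (Fin n))).symm.continuous.measurable.comp
    (measurable_fderiv ℝ f)

/-- The linear functional of the polar point lies below the gauge and agrees with it at `z`, so it
is a subgradient there; differentiability leaves only one. -/
theorem polarPoint_eq_gradient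
    (hK : (0 : EuclideanSpace ℝ (Fin n)) ∈ interior (K : Set (EuclideanSpace ℝ (Fin n))))
    {z : EuclideanSpace ℝ (Fin n)} (hz : z ≠ 0) (hd : DifferentiableAt ℝ (gauge (K : Set _)) z)
    {u : Metric.sphere (0 : EuclideanSpace ℝ (Fin n)) 1}
    (hu : IsOuterNormal (K : Set _) ((gauge (K : Set _) z)⁻¹ • z) u) :
    polarPoint (K : Set _) (u : EuclideanSpace ℝ (Fin n)) = gradient (gauge (K : Set _)) z := by
  refine eq_gradient_of_subgradient hd fun w => ?_
  have h0 := (gauge_pos_iff hK).2 hz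
  rw [isOuterNormal_iff_inner_polarPoint hK, real_inner_smul_right, inv_mul_eq_one₀ h0.ne'] at hu
  rw [inner_sub_right, ← hu]
  exact sub_le_sub_right (inner_polarPoint_le_gauge hK (sphere_coe_ne_zero u) w) _

theorem mem_regularBoundary_of_differentiableAt
    (hK : (0 : EuclideanSpace ℝ (Fin n)) ∈ interior (K : Set (EuclideanSpace ℝ (Fin n))))
    {z : EuclideanSpace ℝ (Fin n)} (hz : z ≠ 0) (hd : DifferentiableAt ℝ (gauge (K : Set _)) z) :
    (gauge (K : Set _) z)⁻¹ • z ∈ regularBoundary (K : Set (EuclideanSpace ℝ (Fin n))) := by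
  have hx := (gauge_eq_one_iff hK).1 (gauge_inv_smul hK hz)
  obtain ⟨u, hu⟩ := exists_isOuterNormal hK hx
  refine ⟨hx, u, hu, fun w hw => polarPoint_injective hK ?_⟩
  exact (polarPoint_eq_gradient hK hz hd hw).trans (polarPoint_eq_gradient hK hz hd hu).symm

theorem exists_polarPoint_eq_gradient
    (hK : (0 : EuclideanSpace ℝ (Fin n)) ∈ interior (K : Set (EuclideanSpace ℝ (Fin n))))
    {z : EuclideanSpace ℝ (Fin n)} (hz : z ≠ 0) (hd : DifferentiableAt ℝ (gauge (K : Set _)) z) :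
    ∃ u : Metric.sphere (0 : EuclideanSpace ℝ (Fin n)) 1,
      polarPoint (K : Set _) (u : EuclideanSpace ℝ (Fin n)) = gradient (gauge (K : Set _)) z ∧
      inner ℝ (polarPoint (K : Set _) (u : EuclideanSpace ℝ (Fin n))) z = gauge (K : Set _) z := by
  obtain ⟨u, hu⟩ := (mem_regularBoundary_of_differentiableAt hK hz hd).2.exists
  refine ⟨u, polarPoint_eq_gradient hK hz hd hu, ?_⟩
  rwa [isOuterNormal_iff_inner_polarPoint hK, real_inner_smul_right,
    inv_mul_eq_one₀ ((gauge_pos_iff hK).2 hz).ne', eq_comm] at hu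

/-- The gauge is homogeneous of degree one, so its gradient has degree zero. The scaling rules for
`fderiv` used here need no differentiability, so the identity holds at every point. -/
theorem gradient_smul_eq
    (K : ConvexBody (EuclideanSpace ℝ (Fin n)))
    {c : ℝ} (hc : 0 < c) (z : EuclideanSpace ℝ (Fin n)) :
    gradient (gauge (K : Set _)) (c • z) = gradient (gauge (K : Set _)) z := by
  have h : gauge (K : Set (EuclideanSpace ℝ (Fin n))) =
      c⁻¹ • fun w => gauge (K : Set (EuclideanSpace ℝ (Fin n))) (c • w) := by
    funext w
    rw [Pi.smul_apply, gauge_smul_eq K hc.le, smul_eq_mul, inv_mul_cancel_left₀ hc.ne']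
  have h2 : fderiv ℝ (gauge (K : Set (EuclideanSpace ℝ (Fin n)))) z =
      fderiv ℝ (gauge (K : Set (EuclideanSpace ℝ (Fin n)))) (c • z) := by
    conv_lhs => rw [h]
    rw [fderiv_const_smul_field, Pi.smul_apply, fderiv_comp_smul, smul_smul, inv_mul_cancel₀ hc.ne', one_smul]
  rw [gradient, gradient, h2]

/-- Rademacher's theorem for the Lipschitz function `gauge K`. -/
theorem ae_differentiableAt_gauge
    (hK : (0 : EuclideanSpace ℝ (Fin n)) ∈ interior (K : Set (EuclideanSpace ℝ (Fin n)))) :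
    ∀ᵐ z, DifferentiableAt ℝ (gauge (K : Set (EuclideanSpace ℝ (Fin n)))) z := by
  obtain ⟨C, hC⟩ := K.convex.lipschitz_gauge (mem_interior_iff_mem_nhds.1 hK)
  exact hC.ae_differentiableAt

end ConvexGeometry

/-! ### Hausdorff measure under near-identity maps, and volumes of cones. -/

section HausdorffMeasure

theorem euclideanHausdorffMeasure_image_le {X Y : Type*} [MetricSpace X] [MeasurableSpace X]
    [BorelSpace X] [MetricSpace Y] [MeasurableSpace Y] [BorelSpace Y] {C : NNReal} {f : X → Y}
    {s : Set X} (hf : LipschitzOnWith C f s) (d : ℕ) :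
    μHE[d] (f '' s) ≤ (C : ENNReal) ^ d * μHE[d] s := by
  have h := hf.hausdorffMeasure_image_le (d := (d : ℝ)) (by positivity)
  rw [ENNReal.rpow_natCast] at h
  simp only [Measure.euclideanHausdorffMeasure_def, Measure.smul_apply, ENNReal.smul_def,
    smul_eq_mul]
  rw [mul_left_comm]
  gcongr

/-- Such a map is bi-Lipschitz: distances change by factors between `1 - c` and `1 + c`. The lower
bound comes from the Lipschitz inverse. -/
theorem euclideanHausdorffMeasure_image_near_id {V : Type*} [NormedAddCommGroup V]
    [MeasurableSpace V] [BorelSpace V] {f : V → V} {s : Set V} {c : ℝ} (hc0 : 0 ≤ c) (hc1 : c < 1)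
    (hf : ∀ z ∈ s, ∀ w ∈ s, ‖f z - f w - (z - w)‖ ≤ c * ‖z - w‖) (d : ℕ) :
    μHE[d] (f '' s) ≤ ENNReal.ofReal (1 + c) ^ d * μHE[d] s ∧
      ENNReal.ofReal (1 - c) ^ d * μHE[d] s ≤ μHE[d] (f '' s) := by
  have h1 : ∀ z ∈ s, ∀ w ∈ s, ‖f z - f w‖ ≤ (1 + c) * ‖z - w‖ := fun z hz w hw => by
    have := norm_add_le (f z - f w - (z - w)) (z - w)
    rw [sub_add_cancel] at this
    linarith [hf z hz w hw]
  have h2 : ∀ z ∈ s, ∀ w ∈ s, (1 - c) * ‖z - w‖ ≤ ‖f z - f w‖ := fun z hz w hw => by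
    have := norm_sub_le (f z - f w) (f z - f w - (z - w))
    rw [sub_sub_cancel] at this
    linarith [hf z hz w hw]
  have hc2 : 0 < 1 - c := by linarith
  have hinj : InjOn f s := fun z hz w hw h => by
    have := h2 z hz w hw
    rw [h, sub_self, norm_zero] at this
    exact sub_eq_zero.1 (norm_le_zero_iff.1 (nonpos_of_mul_nonpos_right this hc2))
  constructor
  · exact euclideanHausdorffMeasure_image_le (C := (1 + c).toNNReal)
      (LipschitzOnWith.of_dist_le_mul fun z hz w hw => by
        rw [dist_eq_norm, dist_eq_norm, Real.coe_toNNReal _ (by positivity)]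
        exact h1 z hz w hw) d
  · have hg : LipschitzOnWith (1 - c)⁻¹.toNNReal (Function.invFunOn f s) (f '' s) := by
      refine LipschitzOnWith.of_dist_le_mul ?_
      rintro _ ⟨z, hz, rfl⟩ _ ⟨w, hw, rfl⟩
      rw [hinj.leftInvOn_invFunOn hz, hinj.leftInvOn_invFunOn hw, dist_eq_norm, dist_eq_norm,
        Real.coe_toNNReal _ (by positivity), ← div_eq_inv_mul, le_div_iff₀' hc2]
      exact h2 z hz w hw
    have h := euclideanHausdorffMeasure_image_le hg d
    rw [hinj.leftInvOn_invFunOn.image_image] at h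
    calc ENNReal.ofReal (1 - c) ^ d * μHE[d] s
        ≤ ENNReal.ofReal (1 - c) ^ d * (((1 - c)⁻¹.toNNReal : ENNReal) ^ d * μHE[d] (f '' s)) := by
          gcongr
      _ = μHE[d] (f '' s) := by
          rw [← mul_assoc, ← mul_pow]
          change (ENNReal.ofReal (1 - c) * ENNReal.ofReal (1 - c)⁻¹) ^ d * _ = _
          rw [← ENNReal.ofReal_mul hc2.le, mul_inv_cancel₀ hc2.ne', ENNReal.ofReal_one, one_pow,
            one_mul]

/-- The set `(0, 1] • A` is the cone over `A` with apex `0`; its volume is `1 / n` times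
height times base for `A` in a hyperplane. -/
theorem volume_cone_of_subset_hyperplane {n : ℕ} (hn : n ≠ 0) {p : EuclideanSpace ℝ (Fin n)}
    (hp : p ≠ 0) {A : Set (EuclideanSpace ℝ (Fin n))} (hA : MeasurableSet A)
    (hAp : ∀ x ∈ A, inner ℝ p x = 1) :
    (n : ENNReal) * volume (Ioc (0 : ℝ) 1 • A) = ENNReal.ofReal ‖p‖⁻¹ * μHE[n - 1] A := by
  have hp' : 0 < ‖p‖ := norm_pos_iff.2 hp
  -- Normalized so that `⟨p, v⟩ = 1`: the hyperplane through `x • v` orthogonal to `v` is then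
  -- exactly `⟨p, ·⟩ = x`.
  set v : EuclideanSpace ℝ (Fin n) := (‖p‖ ^ 2)⁻¹ • p with hv
  have hv0 : v ≠ 0 := smul_ne_zero (by positivity) hp
  have hpv : inner ℝ p v = 1 := by
    rw [hv, real_inner_smul_right, real_inner_self_eq_norm_sq, inv_mul_cancel₀ (by positivity)]
  have hnv : ‖v‖ₑ = ENNReal.ofReal ‖p‖⁻¹ := by
    rw [← ofReal_norm, hv, norm_smul, norm_inv, norm_pow, norm_norm]
    congr 1
    field_simp
  have hcone : Ioc (0 : ℝ) 1 • A =
      {z | inner ℝ p z ∈ Ioc (0 : ℝ) 1 ∧ (inner ℝ p z)⁻¹ • z ∈ A} := by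
    ext z
    simp only [Set.mem_smul, mem_ofPred_eq]
    constructor
    · rintro ⟨s, hs, y, hy, rfl⟩
      rw [real_inner_smul_right, hAp y hy, mul_one, smul_smul, inv_mul_cancel₀ hs.1.ne', one_smul]
      exact ⟨hs, hy⟩
    · rintro ⟨hs, hy⟩
      exact ⟨_, hs, _, hy, smul_inv_smul₀ hs.1.ne' z⟩
  have hm : MeasurableSet (Ioc (0 : ℝ) 1 • A) := by
    rw [hcone]
    have h1 : Measurable fun z : EuclideanSpace ℝ (Fin n) => inner ℝ p z :=
      Continuous.measurable (by fun_prop)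
    exact (h1 measurableSet_Ioc).inter ((h1.inv.smul measurable_id) hA)
  -- The slice of the cone at height `x` is `x • A`, hence the factor `x ^ (n - 1)`, whose integral
  -- over `(0, 1]` supplies the `1 / n`.
  have hslice : ∀ x : ℝ, μHE[n - 1] (Ioc (0 : ℝ) 1 • A ∩
      (AffineSubspace.mk' (x • v +ᵥ (0 : EuclideanSpace ℝ (Fin n))) (Submodule.span ℝ {v})ᗮ :
        Set (EuclideanSpace ℝ (Fin n)))) =
      (Ioc (0 : ℝ) 1).indicator (fun x => ENNReal.ofReal (x ^ (n - 1))) x * μHE[n - 1] A := by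
    intro x
    have hmem : ∀ z : EuclideanSpace ℝ (Fin n), z ∈ (AffineSubspace.mk'
        (x • v +ᵥ (0 : EuclideanSpace ℝ (Fin n))) (Submodule.span ℝ {v})ᗮ :
        Set (EuclideanSpace ℝ (Fin n))) ↔ inner ℝ p z = x := by
      intro z
      rw [SetLike.mem_coe, AffineSubspace.mem_mk', Submodule.mem_orthogonal_singleton_iff_inner_right]
      rw [vadd_eq_add, add_zero, vsub_eq_sub, hv, real_inner_smul_left, ← hv, mul_eq_zero,
        inner_sub_right, real_inner_smul_right, hpv, mul_one, sub_eq_zero]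
      exact or_iff_right (by positivity)
    by_cases hx : x ∈ Ioc (0 : ℝ) 1
    · rw [indicator_of_mem hx]
      have : Ioc (0 : ℝ) 1 • A ∩ (AffineSubspace.mk'
          (x • v +ᵥ (0 : EuclideanSpace ℝ (Fin n))) (Submodule.span ℝ {v})ᗮ :
          Set (EuclideanSpace ℝ (Fin n))) = x • A := by
        ext z
        rw [mem_inter_iff, hmem, hcone, mem_smul_set_iff_inv_smul_mem₀ hx.1.ne']
        constructor
        · rintro ⟨⟨-, h⟩, rfl⟩
          exact h
        · intro h
          have h1 := hAp _ h
          rw [real_inner_smul_right, inv_mul_eq_one₀ hx.1.ne'] at h1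
          subst h1
          exact ⟨⟨hx, h⟩, rfl⟩
      rw [this, Measure.euclideanHausdorffMeasure_smul₀ _ hx.1.ne', ENNReal.smul_def, smul_eq_mul,
        ENNReal.coe_pow, ENNReal.ofReal_pow hx.1.le, ← enorm_eq_nnnorm, Real.enorm_of_nonneg hx.1.le]
    · rw [indicator_of_notMem hx, zero_mul]
      convert measure_empty (μ := (μHE[n - 1] : Measure (EuclideanSpace ℝ (Fin n))))
      rw [eq_empty_iff_forall_notMem]
      rintro z ⟨hz, hz'⟩
      rw [hmem] at hz'
      rw [hcone, mem_ofPred_eq, hz'] at hz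
      exact hx hz.1
  have key := EuclideanGeometry.euclideanHausdorffMeasure_eq_lintegral
    (0 : EuclideanSpace ℝ (Fin n)) hv0 hm
  rw [finrank_euclideanSpace_fin, EuclideanSpace.euclideanHausdorffMeasure_eq_volume] at key
  simp_rw [hslice] at key
  have hint : ∫⁻ x : ℝ in Ioc (0 : ℝ) 1, ENNReal.ofReal (x ^ (n - 1)) = ENNReal.ofReal (n : ℝ)⁻¹ := by
    rw [← ofReal_integral_eq_lintegral_ofReal]
    · rw [← intervalIntegral.integral_of_le zero_le_one, integral_pow]
      have : ((n - 1 : ℕ) : ℝ) + 1 = n := by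
        exact_mod_cast Nat.sub_add_cancel (Nat.one_le_iff_ne_zero.2 hn)
      rw [this, one_pow, zero_pow (by omega), sub_zero, one_div]
    · exact ((continuous_pow _).integrableOn_Icc).mono_set Ioc_subset_Icc_self
    · filter_upwards [ae_restrict_mem measurableSet_Ioc] with x hx
      exact pow_nonneg hx.1.le _
  rw [lintegral_mul_const _ (Measurable.indicator (by fun_prop) measurableSet_Ioc),
    lintegral_indicator measurableSet_Ioc, hint, hnv] at key
  rw [key, mul_left_comm, ← mul_assoc (n : ENNReal), ← ENNReal.ofReal_natCast n,
    ← ENNReal.ofReal_mul (by positivity), mul_inv_cancel₀ (by positivity), ENNReal.ofReal_one,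
    one_mul]

end HausdorffMeasure

/-! ### Comparing measures on small sets. -/

section Comparison

/-- Measures that are comparable up to factors arbitrarily close to `1` on small sets. -/
theorem measure_le_of_forall_small {X : Type*} [PseudoMetricSpace X] [SecondCountableTopology X]
    [MeasurableSpace X] [BorelSpace X] {μ ν : Measure X}
    (h : ∀ ε : ℝ, 0 < ε → ∃ δ : ℝ, 0 < δ ∧ ∀ B, MeasurableSet B →
      (∀ x ∈ B, ∀ y ∈ B, dist x y ≤ δ) → μ B ≤ ENNReal.ofReal (1 + ε) * ν B) : μ ≤ ν := by
  rcases isEmpty_or_nonempty X with hX | hX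
  · exact (Measure.eq_zero_of_isEmpty μ).le.trans (Measure.zero_le ν)
  refine Measure.le_iff.2 fun B hB => ?_
  have key : ∀ ε : ℝ, 0 < ε → μ B ≤ ENNReal.ofReal (1 + ε) * ν B := by
    intro ε hε
    obtain ⟨δ, hδ, hs⟩ := h ε hε
    -- Balls of radius `δ / 2` around a dense sequence, made disjoint: a countable partition into
    -- pieces of diameter at most `δ`.
    let D : ℕ → Set X := disjointed fun i => Metric.ball (TopologicalSpace.denseSeq X i) (δ / 2)
    have hDm : ∀ i, MeasurableSet (D i) :=
      MeasurableSet.disjointed fun i => Metric.isOpen_ball.measurableSet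
    have hDd : Pairwise (Function.onFun Disjoint D) := disjoint_disjointed _
    have hDu : ⋃ i, D i = univ := by
      rw [iUnion_disjointed, eq_univ_iff_forall]
      intro x
      obtain ⟨i, hi⟩ := (TopologicalSpace.denseRange_denseSeq X).exists_dist_lt x (half_pos hδ)
      exact mem_iUnion.2 ⟨i, hi⟩
    have hsum : ∀ κ : Measure X, κ B = ∑' i, κ (B ∩ D i) := fun κ => by
      rw [← measure_iUnion (fun i j hij => (hDd hij).mono inter_subset_right inter_subset_right)
        fun i => hB.inter (hDm i), ← inter_iUnion, hDu, inter_univ]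
    rw [hsum μ, hsum ν, ← ENNReal.tsum_mul_left]
    refine ENNReal.tsum_le_tsum fun i => hs _ (hB.inter (hDm i)) fun x hx y hy => ?_
    have hx' := Metric.mem_ball.1 (disjointed_subset _ i hx.2)
    have hy' := Metric.mem_ball.1 (disjointed_subset _ i hy.2)
    linarith [dist_triangle_right x y (TopologicalSpace.denseSeq X i)]
  have hlim : Tendsto (fun ε : ℝ => ENNReal.ofReal (1 + ε) * ν B) (𝓝[>] 0)
      (𝓝 (ENNReal.ofReal (1 + 0) * ν B)) := by
    refine ENNReal.Tendsto.mul_const ?_ (Or.inl (by simp))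
    exact (ENNReal.continuous_ofReal.comp (continuous_const.add continuous_id)).continuousAt.tendsto.mono_left
      nhdsWithin_le_nhds
  rw [add_zero, ENNReal.ofReal_one, one_mul] at hlim
  exact ge_of_tendsto hlim (eventually_nhdsWithin_of_forall key)

theorem exists_ratio_pow_le (n : ℕ) {ε : ℝ} (hε : 0 < ε) :
    ∃ c : ℝ, 0 < c ∧ c < 1 ∧ ((1 + c) / (1 - c)) ^ n ≤ 1 + ε := by
  have hc : ContinuousAt (fun c : ℝ => ((1 + c) / (1 - c)) ^ n) 0 :=
    ((continuousAt_const.add continuousAt_id).div (continuousAt_const.sub continuousAt_id)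
      (by simp)).pow n
  have h1 : ∀ᶠ c in 𝓝 (0 : ℝ), ((1 + c) / (1 - c)) ^ n < 1 + ε :=
    hc.tendsto.eventually_lt_const (by simpa using hε)
  have h2 : ∀ᶠ c in 𝓝[>] (0 : ℝ), c < 1 :=
    nhdsWithin_le_nhds (eventually_lt_nhds zero_lt_one)
  obtain ⟨c, ⟨h3, h4⟩, h5⟩ :=
    (((h1.filter_mono nhdsWithin_le_nhds).and h2).and self_mem_nhdsWithin).exists
  exact ⟨c, h5, h4, h3.le⟩

theorem le_ratio_pow_mul {n : ℕ} {c : ℝ} (hc0 : 0 ≤ c) (hc1 : c < 1) {x y : ENNReal}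
    (h : ENNReal.ofReal (1 - c) ^ n * x ≤ ENNReal.ofReal (1 + c) ^ n * y) :
    x ≤ ENNReal.ofReal (((1 + c) / (1 - c)) ^ n) * y := by
  have hc : 0 < 1 - c := by linarith
  have h0 : ENNReal.ofReal (1 - c) ^ n ≠ 0 := pow_ne_zero _ (by simpa using hc1)
  have ht : ENNReal.ofReal (1 - c) ^ n ≠ ⊤ := by finiteness
  rw [div_pow, ENNReal.ofReal_div_of_pos (pow_pos hc n), ENNReal.ofReal_pow (by linarith),
    ENNReal.ofReal_pow hc.le,
    ENNReal.mul_comm_div, ← mul_div_assoc, ENNReal.le_div_iff_mul_le (Or.inl h0) (Or.inl ht),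
    mul_comm]
  exact h

end Comparison

/-! ### The cone-volume identity for the surface area measure. -/

section SurfaceArea

variable {n : ℕ} {K M : ConvexBody (EuclideanSpace ℝ (Fin n))}

/-- The measure `h_K dS(K, ·)`, transported to the boundary of the polar body. -/
noncomputable def polarSurfaceMeasure (K : Set (EuclideanSpace ℝ (Fin n))) :
    Measure (EuclideanSpace ℝ (Fin n)) :=
  ((surfaceAreaMeasure K).withDensity fun u => ENNReal.ofReal (supportFun K u)).map
    fun u : Metric.sphere (0 : EuclideanSpace ℝ (Fin n)) 1 =>
      polarPoint K (u : EuclideanSpace ℝ (Fin n))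

/-- The image of the volume measure on `K` under the gradient of the gauge. -/
noncomputable def gradientMeasure (K : Set (EuclideanSpace ℝ (Fin n))) :
    Measure (EuclideanSpace ℝ (Fin n)) :=
  (volume.restrict K).map (gradient (gauge K))

/-- The regular boundary points whose normal corresponds to a polar boundary point in `B`. -/
def boundaryPart (K B : Set (EuclideanSpace ℝ (Fin n))) : Set (EuclideanSpace ℝ (Fin n)) :=
  Subtype.val '' (gaussMap K ⁻¹' ((fun u : Metric.sphere (0 : EuclideanSpace ℝ (Fin n)) 1 =>
      polarPoint K (u : EuclideanSpace ℝ (Fin n))) ⁻¹' B))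

theorem measurableSet_boundaryPart
    (hK : (0 : EuclideanSpace ℝ (Fin n)) ∈ interior (K : Set (EuclideanSpace ℝ (Fin n))))
    {B : Set (EuclideanSpace ℝ (Fin n))} (hB : MeasurableSet B) :
    MeasurableSet (boundaryPart (K : Set _) B) :=
  (measurableSet_regularBoundary K).subtype_image
    ((continuous_gaussMap K).measurable ((continuous_polarPoint hK).measurable hB))

/-- Off a null set, the gradient at `z` is read off from the normal at the radial projection of `z`,
so the part of `K` with gradient in `B` is a cone over a piece of the boundary. -/
theorem gradientMeasure_apply
    (hn : n ≠ 0)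
    (hK : (0 : EuclideanSpace ℝ (Fin n)) ∈ interior (K : Set (EuclideanSpace ℝ (Fin n))))
    {B : Set (EuclideanSpace ℝ (Fin n))} (hB : MeasurableSet B) :
    gradientMeasure (K : Set _) B = volume (Ioc (0 : ℝ) 1 • boundaryPart (K : Set _) B) := by
  have : Nonempty (Fin n) := ⟨⟨0, by omega⟩⟩
  have h0 : ∀ᵐ z : EuclideanSpace ℝ (Fin n), z ≠ 0 := compl_mem_ae_iff.2 (measure_singleton 0)
  rw [gradientMeasure, Measure.map_apply (measurable_gradient _) hB,
    Measure.restrict_apply (measurable_gradient _ hB)]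
  refine measure_congr ?_
  filter_upwards [ae_differentiableAt_gauge hK, h0] with z hd hz
  refine propext ?_
  change z ∈ gradient (gauge (K : Set _)) ⁻¹' B ∩ (K : Set _) ↔
    z ∈ Ioc (0 : ℝ) 1 • boundaryPart (K : Set _) B
  have hg := (gauge_pos_iff hK).2 hz
  constructor
  · rintro ⟨hzB, hzK⟩
    refine Set.mem_smul.2 ⟨gauge (K : Set _) z, ⟨hg, (gauge_le_one_iff hK).2 hzK⟩,
      (gauge (K : Set _) z)⁻¹ • z, ⟨⟨_, mem_regularBoundary_of_differentiableAt hK hz hd⟩, ?_, rfl⟩,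
      smul_inv_smul₀ hg.ne' z⟩
    rw [mem_preimage, mem_preimage]
    rw [polarPoint_eq_gradient hK hz hd (isOuterNormal_gaussMap _ _)]
    exact hzB
  · intro h
    obtain ⟨s, hs, _, ⟨x, hx, rfl⟩, rfl⟩ := Set.mem_smul.1 h
    have hx1 := (gauge_eq_one_iff hK).2 x.2.1
    have hgz : gauge (K : Set _) (s • (x : EuclideanSpace ℝ (Fin n))) = s := by
      rw [gauge_smul_eq K hs.1.le, hx1, mul_one]
    refine ⟨?_, (gauge_le_one_iff hK).1 (hgz.trans_le hs.2)⟩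
    rw [mem_preimage, ← polarPoint_eq_gradient hK hz hd (u := gaussMap _ x)]
    · exact hx
    · rw [hgz, inv_smul_smul₀ hs.1.ne']
      exact isOuterNormal_gaussMap _ x

/-- The points of a cone on which the gauge is given by polar points near `p` are moved by less
than `c` times their distance under the map that flattens the boundary. -/
theorem norm_flatten_sub_le
    (hK : (0 : EuclideanSpace ℝ (Fin n)) ∈ interior (K : Set (EuclideanSpace ℝ (Fin n))))
    {p : EuclideanSpace ℝ (Fin n)} {δ : ℝ} (v : EuclideanSpace ℝ (Fin n))
    {z w : EuclideanSpace ℝ (Fin n)} {a b : Metric.sphere (0 : EuclideanSpace ℝ (Fin n)) 1}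
    (ha : dist (polarPoint (K : Set _) (a : EuclideanSpace ℝ (Fin n))) p ≤ δ)
    (hb : dist (polarPoint (K : Set _) (b : EuclideanSpace ℝ (Fin n))) p ≤ δ)
    (haz : inner ℝ (polarPoint (K : Set _) (a : EuclideanSpace ℝ (Fin n))) z =
      gauge (K : Set _) z)
    (hbw : inner ℝ (polarPoint (K : Set _) (b : EuclideanSpace ℝ (Fin n))) w =
      gauge (K : Set _) w) :
    ‖(z + (gauge (K : Set _) z - inner ℝ p z) • v) - (w + (gauge (K : Set _) w - inner ℝ p w) • v)
      - (z - w)‖ ≤ δ * ‖v‖ * ‖z - w‖ := by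
  have e : (z + (gauge (K : Set _) z - inner ℝ p z) • v) -
      (w + (gauge (K : Set _) w - inner ℝ p w) • v) - (z - w) =
      (gauge (K : Set _) z - gauge (K : Set _) w - inner ℝ p (z - w)) • v := by
    rw [inner_sub_right]
    module
  rw [e, norm_smul, mul_right_comm]
  refine mul_le_mul_of_nonneg_right ?_ (norm_nonneg v)
  rw [dist_eq_norm] at ha hb
  have h1 := inner_polarPoint_le_gauge hK (sphere_coe_ne_zero a) w
  have h2 := inner_polarPoint_le_gauge hK (sphere_coe_ne_zero b) z
  have h3 := (real_inner_le_norm (polarPoint (K : Set _) (a : EuclideanSpace ℝ (Fin n)) - p)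
    (z - w)).trans (mul_le_mul_of_nonneg_right ha (norm_nonneg _))
  have h4 := (abs_le.1 ((abs_real_inner_le_norm
    (polarPoint (K : Set _) (b : EuclideanSpace ℝ (Fin n)) - p)
    (z - w)).trans (mul_le_mul_of_nonneg_right hb (norm_nonneg _)))).1
  rw [Real.norm_eq_abs, abs_le]
  simp only [inner_sub_left, inner_sub_right] at h3 h4 ⊢
  constructor <;> linarith

theorem polarSurfaceMeasure_apply
    (hK : (0 : EuclideanSpace ℝ (Fin n)) ∈ interior (K : Set (EuclideanSpace ℝ (Fin n))))
    {B : Set (EuclideanSpace ℝ (Fin n))} (hB : MeasurableSet B) :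
    polarSurfaceMeasure (K : Set _) B = ∫⁻ u in
      (fun u : Metric.sphere (0 : EuclideanSpace ℝ (Fin n)) 1 =>
        polarPoint (K : Set _) (u : EuclideanSpace ℝ (Fin n))) ⁻¹' B,
      ENNReal.ofReal (supportFun (K : Set _) (u : EuclideanSpace ℝ (Fin n)))
        ∂surfaceAreaMeasure (K : Set _) := by
  rw [polarSurfaceMeasure, Measure.map_apply (continuous_polarPoint hK).measurable hB,
    withDensity_apply _ ((continuous_polarPoint hK).measurable hB)]

theorem surfaceAreaMeasure_preimage_polarPoint
    (hK : (0 : EuclideanSpace ℝ (Fin n)) ∈ interior (K : Set (EuclideanSpace ℝ (Fin n))))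
    {B : Set (EuclideanSpace ℝ (Fin n))} (hB : MeasurableSet B) :
    surfaceAreaMeasure (K : Set _) ((fun u : Metric.sphere (0 : EuclideanSpace ℝ (Fin n)) 1 =>
        polarPoint (K : Set _) (u : EuclideanSpace ℝ (Fin n))) ⁻¹' B) =
      μHE[n - 1] (boundaryPart (K : Set _) B) :=
  surfaceAreaMeasure_apply K ((continuous_polarPoint hK).measurable hB)

/-- The polar point has norm `1 / h_K(u)`. If it is within `c ‖p‖` of `p`, the density `h_K` may be
replaced by the constant `‖p‖⁻¹` at the cost of a factor `1 ± c`. -/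
theorem polarSurfaceMeasure_bounds
    (hK : (0 : EuclideanSpace ℝ (Fin n)) ∈ interior (K : Set (EuclideanSpace ℝ (Fin n))))
    {B : Set (EuclideanSpace ℝ (Fin n))} (hB : MeasurableSet B)
    {p : EuclideanSpace ℝ (Fin n)} (hp : p ≠ 0) {c : ℝ} (hc0 : 0 ≤ c) (hc1 : c < 1)
    (hBp : ∀ q ∈ B, dist q p ≤ c * ‖p‖) :
    ENNReal.ofReal (1 - c) * polarSurfaceMeasure (K : Set _) B ≤
        ENNReal.ofReal ‖p‖⁻¹ * μHE[n - 1] (boundaryPart (K : Set _) B) ∧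
      ENNReal.ofReal ‖p‖⁻¹ * μHE[n - 1] (boundaryPart (K : Set _) B) ≤
        ENNReal.ofReal (1 + c) * polarSurfaceMeasure (K : Set _) B := by
  have hp' : 0 < ‖p‖ := norm_pos_iff.2 hp
  have hm := (continuous_polarPoint hK).measurable hB
  have hsm : Measurable fun u : Metric.sphere (0 : EuclideanSpace ℝ (Fin n)) 1 =>
      ENNReal.ofReal (supportFun (K : Set _) (u : EuclideanSpace ℝ (Fin n))) :=
    (((continuous_supportFun K).comp continuous_subtype_val).measurable).ennreal_ofReal
  have hb : ∀ u : Metric.sphere (0 : EuclideanSpace ℝ (Fin n)) 1,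
      polarPoint (K : Set _) (u : EuclideanSpace ℝ (Fin n)) ∈ B →
      (1 - c) * supportFun (K : Set _) (u : EuclideanSpace ℝ (Fin n)) ≤ ‖p‖⁻¹ ∧
      ‖p‖⁻¹ ≤ (1 + c) * supportFun (K : Set _) (u : EuclideanSpace ℝ (Fin n)) := by
    intro u hu
    have h1 := hBp _ hu
    have h2 := norm_polarPoint hK u
    have h3 := supportFun_pos hK (sphere_coe_ne_zero u)
    rw [dist_eq_norm] at h1
    have h4 := (abs_le.1 (abs_norm_sub_norm_le (polarPoint (K : Set _)
      (u : EuclideanSpace ℝ (Fin n))) p))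
    rw [h2] at h4
    set s := supportFun (K : Set _) (u : EuclideanSpace ℝ (Fin n))
    constructor
    · rw [← div_eq_mul_inv (1 : ℝ) ‖p‖ |>.trans (one_mul _), le_div_iff₀ hp', mul_right_comm,
        ← le_div_iff₀ h3, one_div]
      linarith
    · rw [← div_eq_mul_inv (1 : ℝ) ‖p‖ |>.trans (one_mul _), div_le_iff₀ hp', mul_right_comm,
        ← div_le_iff₀ h3, one_div]
      linarith
  rw [polarSurfaceMeasure_apply hK hB, ← surfaceAreaMeasure_preimage_polarPoint hK hB,
    ← lintegral_const_mul _ hsm, ← lintegral_const_mul _ hsm, ← setLIntegral_const]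
  constructor
  · refine setLIntegral_mono' hm fun u hu => ?_
    rw [← ENNReal.ofReal_mul (by linarith)]
    exact ENNReal.ofReal_le_ofReal (hb u hu).1
  · refine setLIntegral_mono' hm fun u hu => ?_
    rw [← ENNReal.ofReal_mul (by linarith)]
    exact ENNReal.ofReal_le_ofReal (hb u hu).2

/-- A boundary piece whose polar points are all near `p` is almost contained in the hyperplane `⟨p,
·⟩ = 1`. Flattening it there makes the cone formula exact. The flattening costs `(1 ± c) ^ (n - 1)`
on the boundary and `(1 ± c) ^ n` on the cone; the density costs one more factor `1 ± c`. -/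
theorem polarSurfaceMeasure_gradientMeasure_compare
    (hn : n ≠ 0)
    (hK : (0 : EuclideanSpace ℝ (Fin n)) ∈ interior (K : Set (EuclideanSpace ℝ (Fin n))))
    {B : Set (EuclideanSpace ℝ (Fin n))} (hB : MeasurableSet B)
    {p : EuclideanSpace ℝ (Fin n)} (hp : p ≠ 0) {c : ℝ} (hc0 : 0 ≤ c) (hc1 : c < 1)
    (hBp : ∀ q ∈ B, dist q p ≤ c * ‖p‖) :
    ENNReal.ofReal (1 - c) ^ n * polarSurfaceMeasure (K : Set _) B ≤
        ENNReal.ofReal (1 + c) ^ n * ((n : ENNReal) * gradientMeasure (K : Set _) B) ∧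
      ENNReal.ofReal (1 - c) ^ n * ((n : ENNReal) * gradientMeasure (K : Set _) B) ≤
        ENNReal.ofReal (1 + c) ^ n * polarSurfaceMeasure (K : Set _) B := by
  have hp' : 0 < ‖p‖ := norm_pos_iff.2 hp
  set v : EuclideanSpace ℝ (Fin n) := (‖p‖ ^ 2)⁻¹ • p with hv
  have hpv : inner ℝ p v = 1 := by
    rw [hv, real_inner_smul_right, real_inner_self_eq_norm_sq, inv_mul_cancel₀ (by positivity)]
  have hnv : c * ‖p‖ * ‖v‖ = c := by
    rw [hv, norm_smul, norm_inv, norm_pow, norm_norm]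
    field_simp
  set A := boundaryPart (K : Set _) B with hA
  -- Since `⟨p, v⟩ = 1`, this map satisfies `⟨p, f z⟩ = g(z)`, so it sends the boundary of `K` into
  -- `⟨p, ·⟩ = 1`. It commutes with nonnegative scalings and therefore maps cones to cones.
  let f : EuclideanSpace ℝ (Fin n) → EuclideanSpace ℝ (Fin n) := fun z =>
    z + (gauge (K : Set _) z - inner ℝ p z) • v
  have hfc : Continuous f := by
    have := continuous_gauge_body hK
    fun_prop
  have hfs : ∀ (s : ℝ) z, 0 ≤ s → f (s • z) = s • f z := by
    intro s z hs
    simp only [f, gauge_smul_eq K hs, real_inner_smul_right]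
    module
  have hcone : ∀ z ∈ Ioc (0 : ℝ) 1 • A, ∃ u : Metric.sphere (0 : EuclideanSpace ℝ (Fin n)) 1,
      polarPoint (K : Set _) (u : EuclideanSpace ℝ (Fin n)) ∈ B ∧
      inner ℝ (polarPoint (K : Set _) (u : EuclideanSpace ℝ (Fin n))) z =
        gauge (K : Set _) z := by
    intro z hz
    obtain ⟨s, hs, _, ⟨x, hx, rfl⟩, rfl⟩ := Set.mem_smul.1 hz
    refine ⟨gaussMap _ x, hx, ?_⟩
    simp only [real_inner_smul_right, gauge_smul_eq K hs.1.le, (gauge_eq_one_iff hK).2 x.2.1,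
      (isOuterNormal_iff_inner_polarPoint hK _ _).1 (isOuterNormal_gaussMap _ x)]
  have hnear : ∀ z ∈ Ioc (0 : ℝ) 1 • A, ∀ w ∈ Ioc (0 : ℝ) 1 • A,
      ‖f z - f w - (z - w)‖ ≤ c * ‖z - w‖ := by
    intro z hz w hw
    obtain ⟨a, ha, haz⟩ := hcone z hz
    obtain ⟨b, hb, hbw⟩ := hcone w hw
    have := norm_flatten_sub_le hK v (hBp _ ha) (hBp _ hb) haz hbw
    rwa [hnv] at this
  have hAc : A ⊆ Ioc (0 : ℝ) 1 • A := fun x hx =>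
    Set.mem_smul.2 ⟨1, ⟨zero_lt_one, le_rfl⟩, x, hx, one_smul _ _⟩
  have hnearA : ∀ z ∈ A, ∀ w ∈ A, ‖f z - f w - (z - w)‖ ≤ c * ‖z - w‖ :=
    fun z hz w hw => hnear z (hAc hz) w (hAc hw)
  have hinj : InjOn f A := by
    intro z hz w hw h
    have h1 := hnearA z hz w hw
    rw [h, sub_self, zero_sub, norm_neg] at h1
    by_contra hne
    have := norm_pos_iff.2 (sub_ne_zero.2 hne)
    nlinarith
  have hAm : MeasurableSet A := measurableSet_boundaryPart hK hB
  have hfAm : MeasurableSet (f '' A) := hAm.image_of_continuousOn_injOn hfc.continuousOn hinj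
  have hfA : ∀ x ∈ f '' A, inner ℝ p x = 1 := by
    rintro _ ⟨x, hx, rfl⟩
    obtain ⟨y, -, rfl⟩ := hx
    simp only [f, inner_add_right, real_inner_smul_right, hpv, (gauge_eq_one_iff hK).2 y.2.1]
    ring
  have himg : f '' (Ioc (0 : ℝ) 1 • A) = Ioc (0 : ℝ) 1 • (f '' A) := by
    ext z
    constructor
    · rintro ⟨w, hw, rfl⟩
      obtain ⟨s, hs, x, hx, rfl⟩ := Set.mem_smul.1 hw
      rw [hfs s x hs.1.le]
      exact smul_mem_smul hs (mem_image_of_mem f hx)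
    · intro hz
      obtain ⟨s, hs, _, ⟨x, hx, rfl⟩, rfl⟩ := Set.mem_smul.1 hz
      exact ⟨s • x, smul_mem_smul hs hx, hfs s x hs.1.le⟩
  have h1 := euclideanHausdorffMeasure_image_near_id hc0 hc1 hnearA (n - 1)
  have h2 := euclideanHausdorffMeasure_image_near_id hc0 hc1 hnear n
  have h3 := volume_cone_of_subset_hyperplane hn hp hfAm hfA
  have h4 := polarSurfaceMeasure_bounds hK hB hp hc0 hc1 hBp
  rw [himg, EuclideanSpace.euclideanHausdorffMeasure_eq_volume] at h2
  rw [← hA] at h4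
  rw [gradientMeasure_apply hn hK hB, ← hA]
  set a := ENNReal.ofReal (1 - c)
  set b := ENNReal.ofReal (1 + c)
  set w := ENNReal.ofReal ‖p‖⁻¹
  have ea : ∀ x : ENNReal, a ^ n * x = a ^ (n - 1) * (a * x) := fun x => by
    rw [← mul_assoc, ← pow_succ, Nat.sub_add_cancel (Nat.one_le_iff_ne_zero.2 hn)]
  have eb : ∀ x : ENNReal, b ^ n * x = b ^ (n - 1) * (b * x) := fun x => by
    rw [← mul_assoc, ← pow_succ, Nat.sub_add_cancel (Nat.one_le_iff_ne_zero.2 hn)]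
  constructor
  · calc a ^ n * polarSurfaceMeasure (K : Set _) B
        ≤ a ^ (n - 1) * (w * μHE[n - 1] A) := by rw [ea]; exact mul_le_mul_right h4.1 _
      _ = w * (a ^ (n - 1) * μHE[n - 1] A) := mul_left_comm _ _ _
      _ ≤ w * μHE[n - 1] (f '' A) := mul_le_mul_right h1.2 _
      _ = n * volume (Ioc (0 : ℝ) 1 • (f '' A)) := h3.symm
      _ ≤ n * (b ^ n * volume (Ioc (0 : ℝ) 1 • A)) := mul_le_mul_right h2.1 _
      _ = b ^ n * (n * volume (Ioc (0 : ℝ) 1 • A)) := mul_left_comm _ _ _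
  · calc a ^ n * (n * volume (Ioc (0 : ℝ) 1 • A))
        = n * (a ^ n * volume (Ioc (0 : ℝ) 1 • A)) := mul_left_comm _ _ _
      _ ≤ n * volume (Ioc (0 : ℝ) 1 • (f '' A)) := mul_le_mul_right h2.2 _
      _ = w * μHE[n - 1] (f '' A) := h3
      _ ≤ w * (b ^ (n - 1) * μHE[n - 1] A) := mul_le_mul_right h1.1 _
      _ = b ^ (n - 1) * (w * μHE[n - 1] A) := mul_left_comm _ _ _
      _ ≤ b ^ n * polarSurfaceMeasure (K : Set _) B := by
          rw [eb]; exact mul_le_mul_right h4.2 _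

theorem polarSurfaceMeasure_compare_small
    (hn : n ≠ 0)
    (hK : (0 : EuclideanSpace ℝ (Fin n)) ∈ interior (K : Set (EuclideanSpace ℝ (Fin n))))
    {ε : ℝ} (hε : 0 < ε) : ∃ δ : ℝ, 0 < δ ∧ ∀ B : Set (EuclideanSpace ℝ (Fin n)),
      MeasurableSet B → (∀ x ∈ B, ∀ y ∈ B, dist x y ≤ δ) →
      polarSurfaceMeasure (K : Set _) B ≤
        ENNReal.ofReal (1 + ε) * ((n : ENNReal) * gradientMeasure (K : Set _) B) ∧
      (n : ENNReal) * gradientMeasure (K : Set _) B ≤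
        ENNReal.ofReal (1 + ε) * polarSurfaceMeasure (K : Set _) B := by
  obtain ⟨c, hc0, hc1, hc⟩ := exists_ratio_pow_le n hε
  obtain ⟨R, hR, hKR⟩ := exists_subset_closedBall K
  -- Every polar point has norm at least `R⁻¹`, so a set of diameter at most `c / R` containing a
  -- polar point `p` lies within `c ‖p‖` of it. A set with no polar point is null for both measures.
  refine ⟨c * R⁻¹, by positivity, fun B hB hBd => ?_⟩
  by_cases hne : ∃ u : Metric.sphere (0 : EuclideanSpace ℝ (Fin n)) 1,
      polarPoint (K : Set _) (u : EuclideanSpace ℝ (Fin n)) ∈ B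
  · obtain ⟨u, hu⟩ := hne
    have hRp : R⁻¹ ≤ ‖polarPoint (K : Set _) (u : EuclideanSpace ℝ (Fin n))‖ := by
      rw [norm_polarPoint hK]
      refine inv_anti₀ (supportFun_pos hK (sphere_coe_ne_zero u)) ?_
      simpa using supportFun_le_norm K hKR (u : EuclideanSpace ℝ (Fin n))
    have hp : polarPoint (K : Set _) (u : EuclideanSpace ℝ (Fin n)) ≠ 0 :=
      norm_pos_iff.1 ((inv_pos.2 hR).trans_le hRp)
    obtain ⟨h1, h2⟩ := polarSurfaceMeasure_gradientMeasure_compare hn hK hB hp hc0.le hc1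
      fun q hq => (hBd q hq _ hu).trans (by gcongr)
    exact ⟨(le_ratio_pow_mul hc0.le hc1 h1).trans (by gcongr),
      (le_ratio_pow_mul hc0.le hc1 h2).trans (by gcongr)⟩
  · have he : (fun u : Metric.sphere (0 : EuclideanSpace ℝ (Fin n)) 1 =>
        polarPoint (K : Set _) (u : EuclideanSpace ℝ (Fin n))) ⁻¹' B = ∅ :=
      eq_empty_iff_forall_notMem.2 fun u hu => hne ⟨u, hu⟩
    have h1 : polarSurfaceMeasure (K : Set _) B = 0 := by
      rw [polarSurfaceMeasure_apply hK hB, he]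
      simp
    have h2 : gradientMeasure (K : Set _) B = 0 := by
      rw [gradientMeasure_apply hn hK hB, boundaryPart, he]
      simp
    simp [h1, h2]

/-- The measure `h_K dS(K, ·)` is `n` times the image of the volume measure on `K`. -/
theorem polarSurfaceMeasure_eq
    (hn : n ≠ 0)
    (hK : (0 : EuclideanSpace ℝ (Fin n)) ∈ interior (K : Set (EuclideanSpace ℝ (Fin n)))) :
    polarSurfaceMeasure (K : Set (EuclideanSpace ℝ (Fin n))) = (n : ENNReal) • gradientMeasure (K : Set _) := by
  refine le_antisymm (measure_le_of_forall_small fun ε hε => ?_)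
    (measure_le_of_forall_small fun ε hε => ?_)
  all_goals obtain ⟨δ, hδ, h⟩ := polarSurfaceMeasure_compare_small hn hK hε
  · exact ⟨δ, hδ, fun B hB hd => (h B hB hd).1⟩
  · exact ⟨δ, hδ, fun B hB hd => (h B hB hd).2⟩

end SurfaceArea

/-! ### The Prékopa-Leindler and Brunn-Minkowski inequalities. -/

section PrekopaLeindler

/-- With `a = max A` and `b = min B`, the translates `b + A` and `a + B` both lie in `A + B` and
meet only in `a + b`. -/
theorem volume_add_volume_le_of_isCompact {A B C : Set ℝ} (hA : IsCompact A) (hB : IsCompact B)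
    (hA0 : A.Nonempty) (hB0 : B.Nonempty) (hC : A + B ⊆ C) :
    volume A + volume B ≤ volume C := by
  obtain ⟨a, ha, ha'⟩ := hA.exists_isGreatest hA0
  obtain ⟨b, hb, hb'⟩ := hB.exists_isLeast hB0
  have hinter : volume ((fun x => b + x) '' A ∩ (fun x => a + x) '' B) = 0 := by
    refine measure_mono_null (t := {a + b}) ?_ (measure_singleton _)
    rintro _ ⟨⟨x, hx, rfl⟩, y, hy, h⟩
    have h1 := ha' hx
    have h2 := hb' hy
    simp only at h
    rw [mem_singleton_iff]
    linarith
  have hm : MeasurableSet ((fun x => a + x) '' B) := (hB.image (by fun_prop)).measurableSet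
  rw [← measure_preimage_add volume (-b) A, ← measure_preimage_add volume (-a) B]
  have e : ∀ (c : ℝ) (S : Set ℝ), (fun x => -c + x) ⁻¹' S = (fun x => c + x) '' S := fun c S => by
    rw [image_add_left]
  rw [e, e, ← measure_union_add_inter _ hm, hinter, add_zero]
  refine measure_mono (union_subset ?_ ?_)
  · rintro _ ⟨x, hx, rfl⟩
    exact hC ⟨x, hx, b, hb, add_comm _ _⟩
  · rintro _ ⟨x, hx, rfl⟩
    exact hC ⟨a, ha, x, hx, rfl⟩

/-- The one-dimensional Brunn-Minkowski inequality. -/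
theorem volume_add_volume_le {A B C : Set ℝ} (hA : MeasurableSet A) (hB : MeasurableSet B)
    (hA0 : A.Nonempty) (hB0 : B.Nonempty) (hC : A + B ⊆ C) :
    volume A + volume B ≤ volume C := by
  obtain ⟨a, ha⟩ := hA0
  obtain ⟨b, hb⟩ := hB0
  rw [hA.measure_eq_iSup_isCompact, hB.measure_eq_iSup_isCompact]
  simp only [iSup_and']
  refine ENNReal.biSup_add_biSup_le' (p := fun S => S ⊆ A ∧ IsCompact S)
    (q := fun S => S ⊆ B ∧ IsCompact S) ⟨∅, empty_subset _, isCompact_empty⟩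
    ⟨∅, empty_subset _, isCompact_empty⟩ fun S hS T hT => ?_
  -- The inner compact sets may be empty; inserting `a` and `b` makes them nonempty.
  refine le_trans (add_le_add (measure_mono (subset_insert a S)) (measure_mono (subset_insert b T)))
    (volume_add_volume_le_of_isCompact (hS.2.insert a) (hT.2.insert b) (insert_nonempty _ _)
      (insert_nonempty _ _) ((add_subset_add ?_ ?_).trans hC))
  · exact insert_subset ha hS.1
  · exact insert_subset hb hT.1

theorem lintegral_eq_lintegral_Ioo_meas_lt {k : ℝ → ENNReal} (hk : Measurable k)
    (hk1 : ∀ x, k x ≤ 1) :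
    ∫⁻ x, k x = ∫⁻ t in Ioo (0 : ℝ) 1, volume {x | ENNReal.ofReal t < k x} := by
  have hkt : ∀ x, k x ≠ ⊤ := fun x => ne_top_of_le_ne_top ENNReal.one_ne_top (hk1 x)
  have h := lintegral_eq_lintegral_meas_lt volume (f := fun x => (k x).toReal)
    (Eventually.of_forall fun x => ENNReal.toReal_nonneg) hk.ennreal_toReal.aemeasurable
  rw [← lintegral_congr fun x => ENNReal.ofReal_toReal (hkt x), h, ← Ioi_inter_Iio,
    inter_comm, ← setLIntegral_indicator measurableSet_Iio]
  refine setLIntegral_congr_fun measurableSet_Ioi fun t ht => ?_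
  by_cases ht1 : t < 1
  · rw [indicator_of_mem (mem_Iio.2 ht1)]
    congr 1
    ext x
    exact (ENNReal.ofReal_lt_iff_lt_toReal (le_of_lt ht) (hkt x)).symm
  · rw [indicator_of_notMem (by simpa using ht1)]
    convert measure_empty (μ := (volume : Measure ℝ))
    rw [eq_empty_iff_forall_notMem]
    intro x hx
    refine ht1 (lt_of_lt_of_le hx ?_)
    exact ENNReal.toReal_le_of_le_ofReal zero_le_one (by simpa using hk1 x)

/-- With both suprema equal to `1`, the superlevel sets of `f` and `g` are nonempty at each level `t
< 1`, so one-dimensional Brunn-Minkowski applies level by level. Integrating over `t` gives the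
stronger bound with an arithmetic mean. -/
theorem prekopa_leindler_real_of_iSup_eq_one {f g h : ℝ → ENNReal} (hf : Measurable f)
    (hg : Measurable g) (hh : Measurable h) {l : ℝ} (hl0 : 0 < l) (hl1 : l < 1)
    (hf1 : ⨆ x, f x = 1) (hg1 : ⨆ x, g x = 1)
    (H : ∀ x y, f x ^ (1 - l) * g y ^ l ≤ h ((1 - l) * x + l * y)) :
    ENNReal.ofReal (1 - l) * (∫⁻ x, f x) + ENNReal.ofReal l * ∫⁻ x, g x ≤ ∫⁻ x, h x := by
  have hl : 0 < 1 - l := by linarith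
  have hf1' : ∀ x, f x ≤ 1 := fun x => hf1 ▸ le_iSup f x
  have hg1' : ∀ x, g x ≤ 1 := fun x => hg1 ▸ le_iSup g x
  have hmeas : ∀ k : ℝ → ENNReal, Measurable fun t : ℝ => volume {x | ENNReal.ofReal t < k x} :=
    fun k => Antitone.measurable fun s t hst =>
      measure_mono fun x hx => (ENNReal.ofReal_le_ofReal hst).trans_lt hx
  calc ENNReal.ofReal (1 - l) * (∫⁻ x, f x) + ENNReal.ofReal l * ∫⁻ x, g x
      = ∫⁻ t in Ioo (0 : ℝ) 1, (ENNReal.ofReal (1 - l) * volume {x | ENNReal.ofReal t < f x} +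
          ENNReal.ofReal l * volume {x | ENNReal.ofReal t < g x}) := by
        rw [lintegral_eq_lintegral_Ioo_meas_lt hf hf1', lintegral_eq_lintegral_Ioo_meas_lt hg hg1',
          lintegral_add_left ((hmeas f).const_mul _), lintegral_const_mul _ (hmeas f),
          lintegral_const_mul _ (hmeas g)]
    -- Truncating `h` at `1` leaves its superlevel sets for `t < 1` unchanged and makes the
    -- layer-cake formula on `(0, 1)` applicable.
    _ ≤ ∫⁻ t in Ioo (0 : ℝ) 1, volume {x | ENNReal.ofReal t < min (h x) 1} := by
        refine setLIntegral_mono' measurableSet_Ioo fun t ht => ?_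
        have ht1 : ENNReal.ofReal t < 1 := by
          rw [← ENNReal.ofReal_one]
          exact (ENNReal.ofReal_lt_ofReal_iff zero_lt_one).2 ht.2
        have e : ∀ (c : ℝ), 0 < c → ∀ S : Set ℝ,
            ENNReal.ofReal c * volume S = volume (c • S) := fun c hc S => by
          rw [Measure.addHaar_smul, Module.finrank_self, pow_one, abs_of_pos hc]
        rw [e _ hl, e _ hl0]
        refine volume_add_volume_le ((measurableSet_lt measurable_const hf).const_smul₀ _)
          ((measurableSet_lt measurable_const hg).const_smul₀ _) ?_ ?_ ?_
        · obtain ⟨x, hx⟩ := lt_iSup_iff.1 (hf1 ▸ ht1)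
          exact ⟨_, smul_mem_smul_set (a := 1 - l) hx⟩
        · obtain ⟨x, hx⟩ := lt_iSup_iff.1 (hg1 ▸ ht1)
          exact ⟨_, smul_mem_smul_set (a := l) hx⟩
        · rintro _ ⟨_, ⟨x, hx, rfl⟩, _, ⟨y, hy, rfl⟩, rfl⟩
          refine lt_min ?_ ht1
          refine lt_of_lt_of_le ?_ (H x y)
          have h0 : ENNReal.ofReal t ≠ 0 := by simpa using ht.1
          have := ENNReal.mul_lt_mul (ENNReal.rpow_lt_rpow hx hl) (ENNReal.rpow_lt_rpow hy hl0)
          rwa [← ENNReal.rpow_add _ _ h0 ENNReal.ofReal_ne_top, sub_add_cancel,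
            ENNReal.rpow_one] at this
    _ = ∫⁻ x, min (h x) 1 :=
        (lintegral_eq_lintegral_Ioo_meas_lt (hh.min measurable_const) fun x => min_le_right _ _).symm
    _ ≤ ∫⁻ x, h x := lintegral_mono fun x => min_le_left _ _

/-- Weighted AM-GM: Young's inequality with the conjugate exponents `1 / (1 - l)` and `1 / l`. -/
theorem rpow_mul_rpow_le_add {l : ℝ} (hl0 : 0 < l) (hl1 : l < 1) (x y : ENNReal) :
    x ^ (1 - l) * y ^ l ≤ ENNReal.ofReal (1 - l) * x + ENNReal.ofReal l * y := by
  have hl : 0 < 1 - l := by linarith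
  have hc : (1 - l)⁻¹.HolderConjugate l⁻¹ := by
    rw [Real.holderConjugate_iff]
    exact ⟨(one_lt_inv₀ hl).2 (by linarith), by simp⟩
  have h := ENNReal.young_inequality (x ^ (1 - l)) (y ^ l) hc
  rwa [← ENNReal.rpow_mul, ← ENNReal.rpow_mul, mul_inv_cancel₀ hl.ne', mul_inv_cancel₀ hl0.ne',
    ENNReal.rpow_one, ENNReal.rpow_one, ENNReal.ofReal_inv_of_pos hl, ENNReal.ofReal_inv_of_pos hl0,
    div_eq_mul_inv, div_eq_mul_inv, inv_inv, inv_inv, mul_comm x, mul_comm y] at h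

/-- Both sides scale alike when `f` and `g` are divided by their suprema; after this normalization
AM-GM weakens the arithmetic mean to the geometric one. -/
theorem prekopa_leindler_real_of_bounded {f g h : ℝ → ENNReal} (hf : Measurable f)
    (hg : Measurable g) (hh : Measurable h) {l : ℝ} (hl0 : 0 < l) (hl1 : l < 1)
    (hfb : ⨆ x, f x ≠ ⊤) (hgb : ⨆ x, g x ≠ ⊤)
    (H : ∀ x y, f x ^ (1 - l) * g y ^ l ≤ h ((1 - l) * x + l * y)) :
    (∫⁻ x, f x) ^ (1 - l) * (∫⁻ x, g x) ^ l ≤ ∫⁻ x, h x := by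
  have hl : 0 < 1 - l := by linarith
  by_cases ha0 : ⨆ x, f x = 0
  · have : f = 0 := funext fun x => by simpa using (le_iSup f x).trans ha0.le
    simp [this, hl]
  by_cases hb0 : ⨆ x, g x = 0
  · have : g = 0 := funext fun x => by simpa using (le_iSup g x).trans hb0.le
    simp [this, hl0]
  set a := ⨆ x, f x with ha
  set b := ⨆ x, g x with hb
  set s := a ^ (1 - l) * b ^ l with hs
  have hs0 : s ≠ 0 := mul_ne_zero (ENNReal.rpow_pos (pos_iff_ne_zero.2 ha0) hfb).ne'
    (ENNReal.rpow_pos (pos_iff_ne_zero.2 hb0) hgb).ne'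
  have hst : s ≠ ⊤ := ENNReal.mul_ne_top (ENNReal.rpow_ne_top_of_nonneg hl.le hfb)
    (ENNReal.rpow_ne_top_of_nonneg hl0.le hgb)
  have e : ∀ x y : ENNReal, (a⁻¹ * x) ^ (1 - l) * (b⁻¹ * y) ^ l = s⁻¹ * (x ^ (1 - l) * y ^ l) := by
    intro x y
    rw [ENNReal.mul_rpow_of_nonneg _ _ hl.le, ENNReal.mul_rpow_of_nonneg _ _ hl0.le,
      ENNReal.inv_rpow, ENNReal.inv_rpow, hs, ENNReal.mul_inv (Or.inr
        (ENNReal.rpow_ne_top_of_nonneg hl0.le hgb)) (Or.inl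
        (ENNReal.rpow_ne_top_of_nonneg hl.le hfb)), mul_mul_mul_comm]
  have h1 := prekopa_leindler_real_of_iSup_eq_one (hf.const_mul a⁻¹) (hg.const_mul b⁻¹)
    (hh.const_mul s⁻¹) hl0 hl1
    (by rw [← ENNReal.mul_iSup, ENNReal.inv_mul_cancel ha0 hfb])
    (by rw [← ENNReal.mul_iSup, ENNReal.inv_mul_cancel hb0 hgb])
    (fun x y => by rw [e]; exact mul_le_mul_right (H x y) _)
  have h2 := (rpow_mul_rpow_le_add hl0 hl1 _ _).trans h1
  rw [lintegral_const_mul _ hf, lintegral_const_mul _ hg, lintegral_const_mul _ hh, e] at h2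
  exact (ENNReal.mul_le_mul_iff_right (ENNReal.inv_ne_zero.2 hst) (ENNReal.inv_ne_top.2 hs0)).1 h2

theorem tendsto_lintegral_min_natCast {f : ℝ → ENNReal} (hf : Measurable f) :
    Tendsto (fun N : ℕ => ∫⁻ x, min (f x) N) atTop (𝓝 (∫⁻ x, f x)) := by
  refine lintegral_tendsto_of_tendsto_of_monotone
    (fun N => (hf.min measurable_const).aemeasurable)
    (Eventually.of_forall fun x N N' hN => min_le_min_left _ (by exact_mod_cast hN))
    (Eventually.of_forall fun x => ?_)
  have := (tendsto_const_nhds (x := f x)).min ENNReal.tendsto_nat_nhds_top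
  rwa [min_top_right] at this

theorem prekopa_leindler_real {f g h : ℝ → ENNReal} (hf : Measurable f)
    (hg : Measurable g) (hh : Measurable h) {l : ℝ} (hl0 : 0 < l) (hl1 : l < 1)
    (H : ∀ x y, f x ^ (1 - l) * g y ^ l ≤ h ((1 - l) * x + l * y)) :
    (∫⁻ x, f x) ^ (1 - l) * (∫⁻ x, g x) ^ l ≤ ∫⁻ x, h x := by
  have hl : 0 < 1 - l := by linarith
  -- Removing the zero cases excludes `0 * ∞`, so the product passes to the limit of the truncations
  -- at height `N`.
  by_cases hf0 : ∫⁻ x, f x = 0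
  · simp [hf0, hl]
  by_cases hg0 : ∫⁻ x, g x = 0
  · simp [hg0, hl0]
  have hlim : Tendsto (fun N : ℕ => (∫⁻ x, min (f x) N) ^ (1 - l) * (∫⁻ x, min (g x) N) ^ l) atTop
      (𝓝 ((∫⁻ x, f x) ^ (1 - l) * (∫⁻ x, g x) ^ l)) := by
    refine ENNReal.Tendsto.mul ((tendsto_lintegral_min_natCast hf).ennrpow_const _) (Or.inl ?_)
      ((tendsto_lintegral_min_natCast hg).ennrpow_const _) (Or.inl ?_)
    · simp [hf0, hl, not_lt.2 hl.le]
    · simp [hg0, hl0, not_lt.2 hl0.le]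
  refine le_of_tendsto hlim (Eventually.of_forall fun N => ?_)
  have hb : ∀ k : ℝ → ENNReal, ⨆ x, min (k x) N ≠ ⊤ := fun k =>
    ne_top_of_le_ne_top (ENNReal.natCast_ne_top N) (iSup_le fun x => min_le_right _ _)
  refine prekopa_leindler_real_of_bounded (hf.min measurable_const) (hg.min measurable_const) hh
    hl0 hl1 (hb f) (hb g) fun x y => le_trans ?_ (H x y)
  gcongr
  · exact min_le_left _ _
  · exact min_le_left _ _

/-- The **Prékopa-Leindler inequality**. -/
theorem prekopa_leindler (n : ℕ) {f g h : (Fin n → ℝ) → ENNReal} (hf : Measurable f)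
    (hg : Measurable g) (hh : Measurable h) {l : ℝ} (hl0 : 0 < l) (hl1 : l < 1)
    (H : ∀ x y, f x ^ (1 - l) * g y ^ l ≤ h ((1 - l) • x + l • y)) :
    (∫⁻ x, f x) ^ (1 - l) * (∫⁻ x, g x) ^ l ≤ ∫⁻ x, h x := by
  induction n with
  | zero =>
    simp only [lintegral_unique, volume_pi, Measure.pi_univ, Finset.univ_eq_empty,
      Finset.prod_empty, mul_one]
    convert H default default
  | succ n ih =>
    have hp := (volume_preserving_piFinSuccAbove (fun _ : Fin (n + 1) => ℝ) 0).symm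
    set e := (MeasurableEquiv.piFinSuccAbove (fun _ : Fin (n + 1) => ℝ) 0).symm with he
    have hadd : ∀ t s y z, e ((1 - l) * t + l * s, (1 - l) • y + l • z) =
        (1 - l) • e (t, y) + l • e (s, z) := by
      intro t s y z
      funext i
      refine Fin.cases ?_ (fun j => ?_) i <;>
        simp [he, MeasurableEquiv.piFinSuccAbove]
    have hint : ∀ {k : (Fin (n + 1) → ℝ) → ENNReal}, Measurable k →
        ∫⁻ x, k x = ∫⁻ t : ℝ, ∫⁻ y : Fin n → ℝ, k (e (t, y)) := by
      intro k hk
      rw [← hp.lintegral_comp hk, Measure.volume_eq_prod,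
        lintegral_prod (fun p => k (e p)) (hk.comp e.measurable).aemeasurable]
    have hm : ∀ {k : (Fin (n + 1) → ℝ) → ENNReal}, Measurable k →
        Measurable fun t : ℝ => ∫⁻ y : Fin n → ℝ, k (e (t, y)) := fun hk =>
      (hk.comp e.measurable).lintegral_prod_right'
    have hs : ∀ {k : (Fin (n + 1) → ℝ) → ENNReal}, Measurable k → ∀ t : ℝ,
        Measurable fun y : Fin n → ℝ => k (e (t, y)) := fun hk t =>
      hk.comp (e.measurable.comp measurable_prodMk_left)
    rw [hint hf, hint hg, hint hh]
    -- The one-dimensional inequality for the slice integrals; its hypothesis is the induction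
    -- hypothesis on each pair of slices.
    refine prekopa_leindler_real (hm hf) (hm hg) (hm hh) hl0 hl1 fun t s => ?_
    refine ih (hs hf t) (hs hg s) (hs hh _) fun y z => ?_
    rw [hadd]
    exact H _ _

theorem volume_rpow_mul_volume_rpow_le {n : ℕ} {A B C : Set (EuclideanSpace ℝ (Fin n))}
    (hA : MeasurableSet A) (hB : MeasurableSet B) (hC : MeasurableSet C) {l : ℝ} (hl0 : 0 < l)
    (hl1 : l < 1) (H : ∀ x ∈ A, ∀ y ∈ B, (1 - l) • x + l • y ∈ C) :
    volume A ^ (1 - l) * volume B ^ l ≤ volume C := by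
  have hl : 0 < 1 - l := by linarith
  have hp := (EuclideanSpace.volume_preserving_symm_measurableEquiv_toLp (Fin n)).symm
  set e := (MeasurableEquiv.toLp 2 (Fin n → ℝ)) with he
  have e1 : ∀ {S : Set (EuclideanSpace ℝ (Fin n))}, MeasurableSet S →
      volume S = ∫⁻ x : Fin n → ℝ, (e ⁻¹' S).indicator 1 x := by
    intro S hS
    rw [lintegral_indicator_one (e.measurable hS)]
    exact (hp.measure_preimage hS.nullMeasurableSet).symm
  rw [e1 hA, e1 hB, e1 hC]
  refine prekopa_leindler n (measurable_one.indicator (e.measurable hA))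
    (measurable_one.indicator (e.measurable hB)) (measurable_one.indicator (e.measurable hC))
    hl0 hl1 fun x y => ?_
  by_cases hx : x ∈ e ⁻¹' A
  · by_cases hy : y ∈ e ⁻¹' B
    · have : (1 - l) • x + l • y ∈ e ⁻¹' C := H _ hx _ hy
      simp [hx, hy, this]
    · simp [hy, hl0]
  · simp [hx, hl]

/-- The **Brunn-Minkowski inequality** for compact sets, in terms of the `n`-th roots `a`, `b` of
the volumes. -/
theorem brunn_minkowski {n : ℕ} {A B : Set (EuclideanSpace ℝ (Fin n))}
    (hA : IsCompact A) (hB : IsCompact B) {a b : ℝ} (ha : 0 < a) (hb : 0 < b)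
    (hAa : volume A = ENNReal.ofReal (a ^ n)) (hBb : volume B = ENNReal.ofReal (b ^ n)) :
    ENNReal.ofReal ((a + b) ^ n) ≤ volume (A + B) := by
  have hab : 0 < a + b := add_pos ha hb
  have hv : ∀ (c : ℝ) (S : Set (EuclideanSpace ℝ (Fin n))), 0 < c →
      volume (c⁻¹ • S) = ENNReal.ofReal ((c ^ n)⁻¹) * volume S := fun c S hc => by
    rw [Measure.addHaar_smul, finrank_euclideanSpace_fin, inv_pow, abs_of_pos (by positivity)]
  -- Both `a⁻¹ • A` and `b⁻¹ • B` have volume `1`, and the weight `l = b / (a + b)` turns `(1 - l) x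
  -- / a + l y / b` into `(x + y) / (a + b)`.
  have h := volume_rpow_mul_volume_rpow_le (A := a⁻¹ • A) (B := b⁻¹ • B) (C := (a + b)⁻¹ • (A + B))
    (hA.smul _).measurableSet (hB.smul _).measurableSet ((hA.add hB).smul _).measurableSet
    (l := b / (a + b)) (by positivity) ((div_lt_one hab).2 (by linarith)) ?_
  · rw [hv a A ha, hv b B hb, hv _ _ hab, hAa, hBb, ← ENNReal.ofReal_mul (by positivity),
      ← ENNReal.ofReal_mul (by positivity), inv_mul_cancel₀ (by positivity),
      inv_mul_cancel₀ (by positivity), ENNReal.ofReal_one, ENNReal.one_rpow, ENNReal.one_rpow,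
      one_mul] at h
    calc ENNReal.ofReal ((a + b) ^ n) = ENNReal.ofReal ((a + b) ^ n) * 1 := (mul_one _).symm
      _ ≤ ENNReal.ofReal ((a + b) ^ n) * (ENNReal.ofReal (((a + b) ^ n)⁻¹) * volume (A + B)) :=
          mul_le_mul_right h _
      _ = volume (A + B) := by
          rw [← mul_assoc, ← ENNReal.ofReal_mul (by positivity), mul_inv_cancel₀ (by positivity),
            ENNReal.ofReal_one, one_mul]
  · rintro _ ⟨x, hx, rfl⟩ _ ⟨y, hy, rfl⟩
    refine ⟨x + y, add_mem_add hx hy, ?_⟩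
    simp only [smul_smul, smul_add]
    congr 2
    · field_simp
      ring
    · field_simp

end PrekopaLeindler

/-! ### Minkowski's first inequality. -/

section Minkowski

variable {n : ℕ} {K M : ConvexBody (EuclideanSpace ℝ (Fin n))}

theorem ae_exists_polarPoint_eq_gradient
    (hn : n ≠ 0)
    (hK : (0 : EuclideanSpace ℝ (Fin n)) ∈ interior (K : Set (EuclideanSpace ℝ (Fin n)))) :
    ∀ᵐ z, z ≠ 0 ∧ ∃ u : Metric.sphere (0 : EuclideanSpace ℝ (Fin n)) 1,
      polarPoint (K : Set _) (u : EuclideanSpace ℝ (Fin n)) = gradient (gauge (K : Set _)) z ∧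
      inner ℝ (polarPoint (K : Set _) (u : EuclideanSpace ℝ (Fin n))) z =
        gauge (K : Set _) z := by
  have : Nonempty (Fin n) := ⟨⟨0, by omega⟩⟩
  have h0 : ∀ᵐ z : EuclideanSpace ℝ (Fin n), z ≠ 0 := compl_mem_ae_iff.2 (measure_singleton 0)
  filter_upwards [ae_differentiableAt_gauge hK, h0] with z hd hz
  exact ⟨hz, exists_polarPoint_eq_gradient hK hz hd⟩

/-- The positive lower bound confines the ratio to a compact part of `(0, ∞)`, which gives
integrability both for it and for its composition with `φ`. -/
theorem exists_supportFun_polarPoint_mem_Icc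
    (hK : (0 : EuclideanSpace ℝ (Fin n)) ∈ interior (K : Set (EuclideanSpace ℝ (Fin n))))
    (hM : (0 : EuclideanSpace ℝ (Fin n)) ∈ interior (M : Set (EuclideanSpace ℝ (Fin n)))) :
    ∃ a b : ℝ, 0 < a ∧ ∀ u : Metric.sphere (0 : EuclideanSpace ℝ (Fin n)) 1,
      supportFun (M : Set _) (polarPoint (K : Set _) (u : EuclideanSpace ℝ (Fin n))) ∈
        Icc a b := by
  obtain ⟨r, hr, hrM⟩ := exists_norm_le_supportFun hM
  obtain ⟨s, hs, hsK⟩ := exists_norm_le_supportFun hK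
  obtain ⟨R, hR, hRM⟩ := exists_subset_closedBall M
  obtain ⟨S, hS, hSK⟩ := exists_subset_closedBall K
  refine ⟨r / S, R / s, by positivity, fun u => ?_⟩
  have h1 := hrM (u : EuclideanSpace ℝ (Fin n))
  have h2 := hsK (u : EuclideanSpace ℝ (Fin n))
  have h3 := supportFun_le_norm M hRM (u : EuclideanSpace ℝ (Fin n))
  have h4 := supportFun_le_norm K hSK (u : EuclideanSpace ℝ (Fin n))
  rw [norm_eq_of_mem_sphere u, mul_one] at h1 h2 h3 h4
  rw [supportFun_polarPoint hK]
  exact ⟨div_le_div₀ (hr.le.trans h1) h1 (hs.trans_le h2) h4,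
    div_le_div₀ hR.le h3 hs h2⟩

theorem measurable_supportFun_gradient (K M : ConvexBody (EuclideanSpace ℝ (Fin n))) :
    Measurable fun z => supportFun (M : Set (EuclideanSpace ℝ (Fin n)))
      (gradient (gauge (K : Set (EuclideanSpace ℝ (Fin n)))) z) :=
  (continuous_supportFun M).measurable.comp (measurable_gradient _)

theorem exists_ae_supportFun_gradient_mem_Icc
    (hn : n ≠ 0)
    (hK : (0 : EuclideanSpace ℝ (Fin n)) ∈ interior (K : Set (EuclideanSpace ℝ (Fin n))))
    (hM : (0 : EuclideanSpace ℝ (Fin n)) ∈ interior (M : Set (EuclideanSpace ℝ (Fin n)))) :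
    ∃ a b : ℝ, 0 < a ∧ ∀ᵐ z : EuclideanSpace ℝ (Fin n),
      supportFun (M : Set _) (gradient (gauge (K : Set _)) z) ∈ Icc a b := by
  obtain ⟨a, b, ha, h⟩ := exists_supportFun_polarPoint_mem_Icc hK hM
  refine ⟨a, b, ha, ?_⟩
  filter_upwards [ae_exists_polarPoint_eq_gradient hn hK] with z ⟨_, u, hu, _⟩
  exact hu ▸ h u

theorem volume_body_ne_top (K : ConvexBody (EuclideanSpace ℝ (Fin n))) :
    volume (K : Set (EuclideanSpace ℝ (Fin n))) ≠ ⊤ :=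
  K.isCompact.measure_ne_top

theorem isFiniteMeasure_restrict_body (K : ConvexBody (EuclideanSpace ℝ (Fin n))) :
    IsFiniteMeasure (volume.restrict (K : Set (EuclideanSpace ℝ (Fin n)))) :=
  isFiniteMeasure_restrict.2 (volume_body_ne_top K)

theorem integrableOn_supportFun_gradient
    (hn : n ≠ 0)
    (hK : (0 : EuclideanSpace ℝ (Fin n)) ∈ interior (K : Set (EuclideanSpace ℝ (Fin n))))
    (hM : (0 : EuclideanSpace ℝ (Fin n)) ∈ interior (M : Set (EuclideanSpace ℝ (Fin n)))) :
    IntegrableOn (fun z => supportFun (M : Set _) (gradient (gauge (K : Set _)) z))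
      (K : Set (EuclideanSpace ℝ (Fin n))) := by
  have := isFiniteMeasure_restrict_body K
  obtain ⟨a, b, ha, h⟩ := exists_ae_supportFun_gradient_mem_Icc hn hK hM
  refine Integrable.of_bound (measurable_supportFun_gradient K M).aestronglyMeasurable b ?_
  filter_upwards [ae_restrict_of_ae h] with z hz
  rw [Real.norm_eq_abs, abs_of_pos (ha.trans_le hz.1)]
  exact hz.2

theorem volume_preimage_gradient_inter_smul
    (K : ConvexBody (EuclideanSpace ℝ (Fin n))) {B : Set (EuclideanSpace ℝ (Fin n))}
    (hB : MeasurableSet B) {s : ℝ} (hs : 0 < s) :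
    volume (gradient (gauge (K : Set _)) ⁻¹' B ∩ s • (K : Set (EuclideanSpace ℝ (Fin n)))) =
      ENNReal.ofReal s ^ n * gradientMeasure (K : Set _) B := by
  have : gradient (gauge (K : Set _)) ⁻¹' B ∩ s • (K : Set (EuclideanSpace ℝ (Fin n))) =
      s • (gradient (gauge (K : Set _)) ⁻¹' B ∩ (K : Set (EuclideanSpace ℝ (Fin n)))) := by
    ext z
    rw [mem_smul_set_iff_inv_smul_mem₀ hs.ne', mem_inter_iff, mem_inter_iff, mem_preimage,
      mem_preimage, gradient_smul_eq K (inv_pos.2 hs), mem_smul_set_iff_inv_smul_mem₀ hs.ne']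
  rw [this, Measure.addHaar_smul, finrank_euclideanSpace_fin, abs_of_pos (by positivity),
    ENNReal.ofReal_pow hs.le, gradientMeasure, Measure.map_apply (measurable_gradient _) hB,
    Measure.restrict_apply (measurable_gradient _ hB)]

theorem gauge_le_of_mem_add_smul
    (hK : (0 : EuclideanSpace ℝ (Fin n)) ∈ interior (K : Set (EuclideanSpace ℝ (Fin n))))
    {t : ℝ} (ht : 0 ≤ t) {z : EuclideanSpace ℝ (Fin n)}
    (hz : z ∈ (K : Set (EuclideanSpace ℝ (Fin n))) + t • (M : Set (EuclideanSpace ℝ (Fin n))))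
    {u : EuclideanSpace ℝ (Fin n)} (hu : u ≠ 0)
    (hug : inner ℝ (polarPoint (K : Set _) u) z = gauge (K : Set _) z) :
    gauge (K : Set _) z ≤ 1 + t * supportFun (M : Set _) (polarPoint (K : Set _) u) := by
  obtain ⟨k, hk, _, ⟨m, hm, rfl⟩, rfl⟩ := hz
  simp only at hug ⊢
  rw [← hug, inner_add_right, real_inner_smul_right]
  exact add_le_add ((inner_polarPoint_le_gauge hK hu k).trans ((gauge_le_one_iff hK).2 hk))
    (mul_le_mul_of_nonneg_left (inner_le_supportFun M hm _) ht)

/-- A point of `K + tM` with gradient `p` has gauge at most `1 + t h_M(p)`. So where the gradient is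
nearly constant the sum lies in a dilate of `K`, and by homogeneity that part of the dilate has
volume about `(1 + t h_M(p)) ^ n` times its share of `K`. Small pieces are compared and summed. -/
theorem volume_add_smul_le
    (hn : n ≠ 0)
    (hK : (0 : EuclideanSpace ℝ (Fin n)) ∈ interior (K : Set (EuclideanSpace ℝ (Fin n))))
    (hM : (0 : EuclideanSpace ℝ (Fin n)) ∈ interior (M : Set (EuclideanSpace ℝ (Fin n))))
    {t : ℝ} (ht : 0 < t) :
    volume ((K : Set (EuclideanSpace ℝ (Fin n))) + t • (M : Set (EuclideanSpace ℝ (Fin n)))) ≤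
      ∫⁻ z in (K : Set (EuclideanSpace ℝ (Fin n))),
        ENNReal.ofReal ((1 + t * supportFun (M : Set _) (gradient (gauge (K : Set _)) z)) ^ n) := by
  set ρ : EuclideanSpace ℝ (Fin n) → ENNReal := fun p =>
    ENNReal.ofReal ((1 + t * supportFun (M : Set _) p) ^ n) with hρ
  have hρm : Measurable ρ := by
    have := continuous_supportFun M
    exact Measurable.ennreal_ofReal (Continuous.measurable (by fun_prop))
  set S := (K : Set (EuclideanSpace ℝ (Fin n))) + t • (M : Set (EuclideanSpace ℝ (Fin n)))
  have key : (volume.restrict S).map (gradient (gauge (K : Set _))) ≤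
      (gradientMeasure (K : Set _)).withDensity ρ := by
    refine measure_le_of_forall_small fun ε hε => ?_
    obtain ⟨c, hc0, hc1, hc⟩ := exists_ratio_pow_le n hε
    obtain ⟨R, hR, hMR⟩ := exists_subset_closedBall M
    -- `h_M` is `R`-Lipschitz, so `t h_M` varies by at most `c` on a set of this diameter.
    refine ⟨c / (t * R), by positivity, fun B hB hd => ?_⟩
    rw [Measure.map_apply (measurable_gradient _) hB,
      Measure.restrict_apply (measurable_gradient _ hB), withDensity_apply _ hB]
    rcases B.eq_empty_or_nonempty with rfl | ⟨p, hp⟩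
    · simp
    have hclose : ∀ x ∈ B, ∀ y ∈ B,
        t * supportFun (M : Set _) x ≤ t * supportFun (M : Set _) y + c := by
      intro x hx y hy
      have h1 := supportFun_le_add M hMR x y
      have h2 := hd x hx y hy
      rw [dist_eq_norm, le_div_iff₀ (by positivity)] at h2
      nlinarith
    have hM0 := supportFun_nonneg hM
    set s := 1 + t * supportFun (M : Set _) p + c with hs
    have hs0 : 0 < s := by
      have := mul_nonneg ht.le (hM0 p)
      linarith
    calc volume (gradient (gauge (K : Set _)) ⁻¹' B ∩ S)
        ≤ volume (gradient (gauge (K : Set _)) ⁻¹' B ∩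
            s • (K : Set (EuclideanSpace ℝ (Fin n)))) := by
          refine measure_mono_ae ?_
          filter_upwards [ae_exists_polarPoint_eq_gradient hn hK] with z ⟨_, u, hu, hug⟩ hz
          refine ⟨hz.1, ?_⟩
          have h1 := gauge_le_of_mem_add_smul hK ht.le hz.2 (sphere_coe_ne_zero u) hug
          rw [hu] at h1
          have h2 := hclose _ hz.1 p hp
          change z ∈ s • (K : Set (EuclideanSpace ℝ (Fin n)))
          rw [mem_smul_set_iff_inv_smul_mem₀ hs0.ne', SetLike.mem_coe, ← SetLike.mem_coe,
            ← gauge_le_one_iff hK, gauge_smul_eq K (inv_nonneg.2 hs0.le), inv_mul_le_iff₀ hs0,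
            mul_one]
          linarith
      _ = ∫⁻ _ in B, ENNReal.ofReal s ^ n ∂gradientMeasure (K : Set _) := by
          rw [volume_preimage_gradient_inter_smul K hB hs0, setLIntegral_const]
      _ ≤ ∫⁻ p in B, ENNReal.ofReal (1 + ε) * ρ p ∂gradientMeasure (K : Set _) := by
          refine setLIntegral_mono' hB fun q hq => ?_
          rw [hρ, ← ENNReal.ofReal_mul (by positivity), ← ENNReal.ofReal_pow hs0.le]
          refine ENNReal.ofReal_le_ofReal ?_
          have h1 := hclose p hp q hq
          have h2 := mul_nonneg ht.le (hM0 q)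
          -- For `q` in `B` one has `s ≤ 1 + t h_M(q) + 2c ≤ (1 + 2c)(1 + t h_M(q))`; this bound
          -- absorbs the factor into `1 + ε`.
          have h3 : 1 + 2 * c ≤ (1 + c) / (1 - c) := by
            rw [le_div_iff₀ (by linarith)]
            nlinarith
          calc s ^ n ≤ ((1 + 2 * c) * (1 + t * supportFun (M : Set _) q)) ^ n := by
                refine pow_le_pow_left₀ hs0.le ?_ n
                nlinarith
            _ = (1 + 2 * c) ^ n * (1 + t * supportFun (M : Set _) q) ^ n := mul_pow _ _ _
            _ ≤ (1 + ε) * (1 + t * supportFun (M : Set _) q) ^ n := by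
                refine mul_le_mul_of_nonneg_right ?_ (by positivity)
                exact (pow_le_pow_left₀ (by positivity) h3 n).trans hc
      _ = ENNReal.ofReal (1 + ε) * ∫⁻ p in B, ρ p ∂gradientMeasure (K : Set _) :=
          lintegral_const_mul _ hρm
  have h := key univ
  rw [Measure.map_apply (measurable_gradient _) MeasurableSet.univ, preimage_univ,
    Measure.restrict_apply_univ, withDensity_apply _ MeasurableSet.univ, Measure.restrict_univ,
    gradientMeasure, lintegral_map hρm (measurable_gradient _)] at h
  exact h

theorem exists_one_add_pow_le (n : ℕ) {C : ℝ} (hC : 0 ≤ C) :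
    ∃ D : ℝ, 0 ≤ D ∧ ∀ x, 0 ≤ x → x ≤ C → (1 + x) ^ n ≤ 1 + n * x + D * x ^ 2 := by
  induction n with
  | zero => exact ⟨0, le_rfl, fun x _ _ => by simp⟩
  | succ n ih =>
    obtain ⟨D, hD, h⟩ := ih
    refine ⟨n + D + D * C, by positivity, fun x hx hxC => ?_⟩
    have h1 := mul_le_mul_of_nonneg_right (h x hx hxC) (by linarith : 0 ≤ 1 + x)
    have h2 : D * x ^ 2 * x ≤ D * x ^ 2 * C := mul_le_mul_of_nonneg_left hxC (by positivity)
    rw [pow_succ]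
    push_cast
    nlinarith

theorem pow_add_le_add_pow (n : ℕ) {a x : ℝ} (ha : 0 < a) (hx : 0 ≤ x) :
    a ^ n + n * a ^ (n - 1) * x ≤ (a + x) ^ n := by
  rcases Nat.eq_zero_or_pos n with rfl | hn
  · simp
  have h := one_add_mul_le_pow (a := x / a) (by linarith [div_nonneg hx ha.le]) n
  have h2 := mul_le_mul_of_nonneg_left h (pow_pos ha n).le
  have e : a * (1 + x / a) = a + x := by field_simp
  rw [← mul_pow, e] at h2
  refine le_trans (le_of_eq ?_) h2
  obtain ⟨k, rfl⟩ := Nat.exists_eq_succ_of_ne_zero hn.ne'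
  simp only [Nat.succ_eq_add_one, Nat.add_sub_cancel, pow_succ]
  field_simp

/-- **Minkowski's first inequality**, in terms of the `n`-th roots `a`, `b` of the volumes. -/
theorem minkowski_first_inequality
    (hn : n ≠ 0)
    (hK : (0 : EuclideanSpace ℝ (Fin n)) ∈ interior (K : Set (EuclideanSpace ℝ (Fin n))))
    (hM : (0 : EuclideanSpace ℝ (Fin n)) ∈ interior (M : Set (EuclideanSpace ℝ (Fin n))))
    {a b : ℝ} (ha : 0 < a) (hb : 0 < b)
    (hKa : volume (K : Set (EuclideanSpace ℝ (Fin n))) = ENNReal.ofReal (a ^ n))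
    (hMb : volume (M : Set (EuclideanSpace ℝ (Fin n))) = ENNReal.ofReal (b ^ n)) :
    a ^ (n - 1) * b ≤ ∫ z in (K : Set (EuclideanSpace ℝ (Fin n))),
      supportFun (M : Set _) (gradient (gauge (K : Set _)) z) := by
  have := isFiniteMeasure_restrict_body K
  obtain ⟨r, C, hr, hC⟩ := exists_ae_supportFun_gradient_mem_Icc hn hK hM
  have hint := integrableOn_supportFun_gradient hn hK hM
  have hC0 : 0 ≤ C := by
    obtain ⟨z, hz⟩ := hC.exists
    linarith [hz.1, hz.2]
  obtain ⟨D, hD, hDx⟩ := exists_one_add_pow_le n hC0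
  set f : EuclideanSpace ℝ (Fin n) → ℝ := fun z =>
    supportFun (M : Set _) (gradient (gauge (K : Set _)) z) with hf
  set V := ∫ z in (K : Set (EuclideanSpace ℝ (Fin n))), f z with hV
  have hn' : (0 : ℝ) < n := by positivity
  -- Brunn-Minkowski gives `(a + tb) ^ n ≤ ∫ (1 + t f) ^ n` over `K`. Bernoulli bounds the left side
  -- below, the right side is expanded with an error of order `t ^ 2`, and `a ^ n` cancels; after
  -- division by `t` an error of order `t` remains.
  have key : ∀ t ∈ Ioo (0 : ℝ) 1, n * (a ^ (n - 1) * b) ≤ n * V + D * C ^ 2 * a ^ n * t := by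
    intro t ht
    have hvt : volume (t • (M : Set (EuclideanSpace ℝ (Fin n)))) =
        ENNReal.ofReal ((t * b) ^ n) := by
      rw [Measure.addHaar_smul, finrank_euclideanSpace_fin, hMb, abs_of_pos (pow_pos ht.1 n),
        ← ENNReal.ofReal_mul (pow_pos ht.1 n).le, mul_pow]
    have h1 := (brunn_minkowski K.isCompact (M.isCompact.smul t) ha (mul_pos ht.1 hb)
      hKa hvt).trans (volume_add_smul_le hn hK hM ht.1)
    have hbd : ∀ᵐ z ∂volume.restrict (K : Set (EuclideanSpace ℝ (Fin n))),
        (1 + t * f z) ^ n ≤ 1 + n * t * f z + D * C ^ 2 * t ^ 2 ∧ 0 ≤ f z := by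
      filter_upwards [ae_restrict_of_ae hC] with z hz
      have hz0 : 0 ≤ f z := hr.le.trans hz.1
      refine ⟨?_, hz0⟩
      refine (hDx (t * f z) (mul_nonneg ht.1.le hz0) ?_).trans ?_
      · exact (mul_le_of_le_one_left hz0 ht.2.le).trans hz.2
      · have h2 : (t * f z) ^ 2 ≤ C ^ 2 * t ^ 2 := by
          rw [mul_pow, mul_comm]
          exact mul_le_mul_of_nonneg_right (pow_le_pow_left₀ hz0 hz.2 2) (by positivity)
        nlinarith
    have hi1 : Integrable (fun z => 1 + n * t * f z)
        (volume.restrict (K : Set (EuclideanSpace ℝ (Fin n)))) :=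
      (integrable_const _).add (hint.const_mul _)
    have hi : Integrable (fun z => 1 + n * t * f z + D * C ^ 2 * t ^ 2)
        (volume.restrict (K : Set (EuclideanSpace ℝ (Fin n)))) :=
      hi1.add (integrable_const _)
    have h3 : ∫⁻ z in (K : Set (EuclideanSpace ℝ (Fin n))), ENNReal.ofReal ((1 + t * f z) ^ n) ≤
        ENNReal.ofReal (∫ z in (K : Set (EuclideanSpace ℝ (Fin n))),
          (1 + n * t * f z + D * C ^ 2 * t ^ 2)) := by
      rw [ofReal_integral_eq_lintegral_ofReal hi]
      · exact lintegral_mono_ae (hbd.mono fun z hz => ENNReal.ofReal_le_ofReal hz.1)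
      · filter_upwards [hbd] with z hz
        have := mul_nonneg (mul_nonneg hn'.le ht.1.le) hz.2
        simp only [Pi.zero_apply]
        positivity
    have hvr : (volume.restrict (K : Set (EuclideanSpace ℝ (Fin n)))).real univ = a ^ n := by
      rw [measureReal_restrict_apply_univ, measureReal_def, hKa,
        ENNReal.toReal_ofReal (pow_pos ha n).le]
    have h4 : ∫ z in (K : Set (EuclideanSpace ℝ (Fin n))),
        (1 + n * t * f z + D * C ^ 2 * t ^ 2) = a ^ n + n * t * V + a ^ n * (D * C ^ 2 * t ^ 2) := by
      rw [integral_add hi1 (integrable_const _),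
        integral_add (integrable_const _) (hint.const_mul _), integral_const_mul, integral_const,
        integral_const, hvr, smul_eq_mul, smul_eq_mul, mul_one]
    have hV0 : 0 ≤ V := integral_nonneg_of_ae (hbd.mono fun z hz => hz.2)
    have h5 := (ENNReal.ofReal_le_ofReal_iff (by rw [h4]; have := ht.1; positivity)).1 (h1.trans h3)
    rw [h4] at h5
    have h6 := (pow_add_le_add_pow n ha (mul_pos ht.1 hb).le).trans h5
    have h7 : t * (n * (a ^ (n - 1) * b)) ≤ t * (n * V + D * C ^ 2 * a ^ n * t) := by linarith
    exact le_of_mul_le_mul_left h7 ht.1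
  have hlim : Tendsto (fun t : ℝ => n * V + D * C ^ 2 * a ^ n * t) (𝓝[>] 0)
      (𝓝 (n * V + D * C ^ 2 * a ^ n * 0)) :=
    (Continuous.tendsto (by fun_prop) 0).mono_left nhdsWithin_le_nhds
  rw [mul_zero, add_zero] at hlim
  have := ge_of_tendsto hlim (by
    filter_upwards [Ioo_mem_nhdsGT (zero_lt_one (α := ℝ))] with t ht using key t ht)
  exact le_of_mul_le_mul_left this hn'

end Minkowski

/-! ### The Orlicz-Minkowski inequality and its equality case. -/

section OrliczMinkowski

variable {n : ℕ} {K M : ConvexBody (EuclideanSpace ℝ (Fin n))}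

theorem orliczMixedVolume_eq_integral_gradient
    (hn : n ≠ 0)
    (hK : (0 : EuclideanSpace ℝ (Fin n)) ∈ interior (K : Set (EuclideanSpace ℝ (Fin n))))
    (hM : (0 : EuclideanSpace ℝ (Fin n)) ∈ interior (M : Set (EuclideanSpace ℝ (Fin n))))
    {φ : ℝ → ℝ} (hφ : ContinuousOn φ (Ioi 0)) :
    orliczMixedVolume φ (K : Set (EuclideanSpace ℝ (Fin n))) M =
      ∫ z in (K : Set (EuclideanSpace ℝ (Fin n))),
        φ (supportFun (M : Set _) (gradient (gauge (K : Set _)) z)) := by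
  classical
  -- Nothing is known of `φ` off `(0, ∞)`; replacing it there by `0` gives a measurable function.
  set ψ : ℝ → ℝ := (Ioi 0).piecewise φ 0 with hψ
  have hψm : Measurable ψ := hφ.measurable_piecewise continuousOn_const measurableSet_Ioi
  have hψφ : ∀ t, 0 < t → ψ t = φ t := fun t ht => piecewise_eq_of_mem _ _ _ ht
  have hψM : Measurable fun p : EuclideanSpace ℝ (Fin n) => ψ (supportFun (M : Set _) p) :=
    hψm.comp (continuous_supportFun M).measurable
  have hs : Measurable fun u : Metric.sphere (0 : EuclideanSpace ℝ (Fin n)) 1 =>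
      ENNReal.ofReal (supportFun (K : Set _) (u : EuclideanSpace ℝ (Fin n))) :=
    (((continuous_supportFun K).comp continuous_subtype_val).measurable).ennreal_ofReal
  have h1 : ∫ u : Metric.sphere (0 : EuclideanSpace ℝ (Fin n)) 1,
      φ (supportFun (M : Set _) (u : EuclideanSpace ℝ (Fin n)) /
        supportFun (K : Set _) (u : EuclideanSpace ℝ (Fin n))) *
        supportFun (K : Set _) (u : EuclideanSpace ℝ (Fin n))
        ∂(surfaceAreaMeasure (K : Set (EuclideanSpace ℝ (Fin n)))) =
      ∫ p, ψ (supportFun (M : Set _) p)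
        ∂polarSurfaceMeasure (K : Set (EuclideanSpace ℝ (Fin n))) := by
    rw [polarSurfaceMeasure, integral_map (continuous_polarPoint hK).measurable.aemeasurable
      hψM.aestronglyMeasurable, integral_withDensity_eq_integral_toReal_smul hs
      (Eventually.of_forall fun _ => ENNReal.ofReal_lt_top)]
    refine integral_congr_ae (Eventually.of_forall fun u => ?_)
    have h0 := supportFun_pos hK (sphere_coe_ne_zero u)
    have h2 := supportFun_pos hM (sphere_coe_ne_zero u)
    simp only [supportFun_polarPoint hK]
    rw [hψφ _ (div_pos h2 h0), ENNReal.toReal_ofReal h0.le, smul_eq_mul, mul_comm]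
  rw [orliczMixedVolume, h1, polarSurfaceMeasure_eq hn hK, integral_smul_measure,
    gradientMeasure, integral_map (measurable_gradient _).aemeasurable hψM.aestronglyMeasurable,
    ENNReal.toReal_natCast, smul_eq_mul, ← mul_assoc, one_div_mul_cancel (by positivity), one_mul]
  obtain ⟨a, b, ha, h⟩ := exists_ae_supportFun_gradient_mem_Icc hn hK hM
  refine integral_congr_ae ?_
  filter_upwards [ae_restrict_of_ae h] with z hz
  exact hψφ _ (ha.trans_le hz.1)

theorem ConvexBody.subset_of_volume_diff_eq_zero
    (hK : (interior (K : Set (EuclideanSpace ℝ (Fin n)))).Nonempty)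
    {S : Set (EuclideanSpace ℝ (Fin n))} (hS : IsClosed S)
    (h : volume ((K : Set (EuclideanSpace ℝ (Fin n))) \ S) = 0) :
    (K : Set (EuclideanSpace ℝ (Fin n))) ⊆ S := by
  have h0 : interior (K : Set (EuclideanSpace ℝ (Fin n))) \ S = ∅ :=
    (isOpen_interior.sdiff hS).eq_empty_of_measure_zero (μ := volume)
      (measure_mono_null (sdiff_subset_sdiff_left interior_subset) h)
  have h1 := hS.closure_subset_iff.2 (sdiff_eq_empty.1 h0)
  rwa [K.convex.closure_interior_eq_closure_of_nonempty_interior hK, K.isClosed.closure_eq] at h1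

/-- The aim is `g(m) ≤ c` for `m ∈ M`, although gradients are controlled only almost everywhere. For
almost every `z` in `K` the gradient `p` satisfies `⟨p, m⟩ ≤ c`, so `g(z) = ⟨p, z⟩ ≤ s c + r⁻¹ ‖z -
s m‖`. This is a closed condition, so it holds on all of `K`, in particular at `z = s m`. -/
theorem subset_smul_of_ae_supportFun_gradient_eq
    (hn : n ≠ 0)
    (hK : (0 : EuclideanSpace ℝ (Fin n)) ∈ interior (K : Set (EuclideanSpace ℝ (Fin n))))
    {c : ℝ} (hc : 0 < c)
    (h : ∀ᵐ z ∂volume.restrict (K : Set (EuclideanSpace ℝ (Fin n))),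
      supportFun (M : Set _) (gradient (gauge (K : Set _)) z) = c) :
    (M : Set (EuclideanSpace ℝ (Fin n))) ⊆ c • (K : Set (EuclideanSpace ℝ (Fin n))) := by
  intro m hm
  rw [mem_smul_set_iff_inv_smul_mem₀ hc.ne', SetLike.mem_coe, ← SetLike.mem_coe,
    ← gauge_le_one_iff hK, gauge_smul_eq K (inv_nonneg.2 hc.le), inv_mul_le_iff₀ hc, mul_one]
  obtain ⟨r, hr, hrK⟩ := exists_norm_le_supportFun hK
  have hg0 := gauge_nonneg (s := (K : Set (EuclideanSpace ℝ (Fin n)))) m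
  -- Small enough that `s • m` lies in `K`; the added `1` avoids dividing by zero.
  set s : ℝ := (gauge (K : Set (EuclideanSpace ℝ (Fin n))) m + 1)⁻¹ with hs
  have hs0 : 0 < s := by positivity
  have hsm : s • m ∈ (K : Set (EuclideanSpace ℝ (Fin n))) := by
    rw [← gauge_le_one_iff hK, gauge_smul_eq K hs0.le, hs, inv_mul_le_iff₀ (by positivity)]
    linarith
  set S : Set (EuclideanSpace ℝ (Fin n)) :=
    {z | gauge (K : Set _) z ≤ s * c + r⁻¹ * ‖z - s • m‖} with hS
  have hSc : IsClosed S := isClosed_le (continuous_gauge_body hK) (by fun_prop)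
  have hKS : (K : Set (EuclideanSpace ℝ (Fin n))) ⊆ S := by
    refine ConvexBody.subset_of_volume_diff_eq_zero ⟨0, hK⟩ hSc ?_
    rw [sdiff_eq, inter_comm, ← Measure.restrict_apply hSc.measurableSet.compl]
    change ∀ᵐ z ∂volume.restrict (K : Set (EuclideanSpace ℝ (Fin n))), z ∈ S
    filter_upwards [h, ae_restrict_of_ae (ae_exists_polarPoint_eq_gradient hn hK)]
      with z hz ⟨_, u, hu, hug⟩
    rw [hS, mem_ofPred_eq, ← hug]
    rw [← hu] at hz
    have h0 := inner_le_supportFun M hm (polarPoint (K : Set _) (u : EuclideanSpace ℝ (Fin n)))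
    rw [hz] at h0
    have h1 := mul_le_mul_of_nonneg_left h0 hs0.le
    have h2 := real_inner_le_norm (polarPoint (K : Set _) (u : EuclideanSpace ℝ (Fin n)))
      (z - s • m)
    have h3 : ‖polarPoint (K : Set _) (u : EuclideanSpace ℝ (Fin n))‖ ≤ r⁻¹ := by
      rw [norm_polarPoint hK]
      refine inv_anti₀ hr ?_
      simpa using hrK (u : EuclideanSpace ℝ (Fin n))
    have h4 := mul_le_mul_of_nonneg_right h3 (norm_nonneg (z - s • m))
    rw [inner_sub_right, real_inner_smul_right] at h2
    linarith
  have := hKS hsm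
  rw [hS, mem_ofPred_eq, sub_self, norm_zero, mul_zero, add_zero, gauge_smul_eq K hs0.le] at this
  exact le_of_mul_le_mul_left this hs0

theorem eq_smul_of_ae_supportFun_gradient_eq
    (hn : n ≠ 0)
    (hK : (0 : EuclideanSpace ℝ (Fin n)) ∈ interior (K : Set (EuclideanSpace ℝ (Fin n))))
    {c : ℝ} (hc : 0 < c)
    (h : ∀ᵐ z ∂volume.restrict (K : Set (EuclideanSpace ℝ (Fin n))),
      supportFun (M : Set _) (gradient (gauge (K : Set _)) z) = c)
    (hv : volume (M : Set (EuclideanSpace ℝ (Fin n))) =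
      ENNReal.ofReal (c ^ n) * volume (K : Set (EuclideanSpace ℝ (Fin n)))) :
    (M : Set (EuclideanSpace ℝ (Fin n))) = c • (K : Set (EuclideanSpace ℝ (Fin n))) := by
  have hsub := subset_smul_of_ae_supportFun_gradient_eq hn hK hc h
  refine hsub.antisymm ?_
  have hvol : volume (c • (K : Set (EuclideanSpace ℝ (Fin n)))) =
      volume (M : Set (EuclideanSpace ℝ (Fin n))) := by
    rw [hv, Measure.addHaar_smul, finrank_euclideanSpace_fin, abs_of_pos (pow_pos hc n)]
  refine ConvexBody.subset_of_volume_diff_eq_zero (K := c • K) ?_ M.isClosed ?_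
  · rw [ConvexBody.coe_smul, interior_smul₀ hc.ne']
    exact ⟨_, smul_mem_smul_set hK⟩
  · rw [ConvexBody.coe_smul, measure_sdiff hsub M.isClosed.measurableSet.nullMeasurableSet
      (volume_body_ne_top M), hvol, tsub_self]

/-- The **Orlicz-Minkowski inequality** together with its equality case, in terms of the `n`-th
roots `a`, `b` of the volumes. -/
theorem orlicz_minkowski_inequality
    (hn : n ≠ 0)
    (hK : (0 : EuclideanSpace ℝ (Fin n)) ∈ interior (K : Set (EuclideanSpace ℝ (Fin n))))
    (hM : (0 : EuclideanSpace ℝ (Fin n)) ∈ interior (M : Set (EuclideanSpace ℝ (Fin n))))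
    {φ : ℝ → ℝ} (hφ : ClassI φ) (hconv : StrictConvexOn ℝ (Ioi 0) φ)
    {a b : ℝ} (ha : 0 < a) (hb : 0 < b)
    (hKa : volume (K : Set (EuclideanSpace ℝ (Fin n))) = ENNReal.ofReal (a ^ n))
    (hMb : volume (M : Set (EuclideanSpace ℝ (Fin n))) = ENNReal.ofReal (b ^ n)) :
    φ (b / a) * a ^ n ≤ orliczMixedVolume φ (K : Set (EuclideanSpace ℝ (Fin n))) M ∧
      (orliczMixedVolume φ (K : Set (EuclideanSpace ℝ (Fin n))) M = φ (b / a) * a ^ n →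
        (M : Set (EuclideanSpace ℝ (Fin n))) = (b / a) • (K : Set (EuclideanSpace ℝ (Fin n)))) := by
  have := isFiniteMeasure_restrict_body K
  obtain ⟨r, R, hr, hrR⟩ := exists_ae_supportFun_gradient_mem_Icc hn hK hM
  have hint := integrableOn_supportFun_gradient hn hK hM
  have hmink := minkowski_first_inequality hn hK hM ha hb hKa hMb
  rw [orliczMixedVolume_eq_integral_gradient hn hK hM hφ.continuousOn]
  set f : EuclideanSpace ℝ (Fin n) → ℝ := fun z =>
    supportFun (M : Set _) (gradient (gauge (K : Set _)) z) with hf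
  have han : 0 < a ^ n := pow_pos ha n
  have hvr : (volume : Measure (EuclideanSpace ℝ (Fin n))).real (K : Set _) = a ^ n := by
    rw [measureReal_def, hKa, ENNReal.toReal_ofReal han.le]
  have hav : ∀ k : EuclideanSpace ℝ (Fin n) → ℝ,
      ⨍ z in (K : Set (EuclideanSpace ℝ (Fin n))), k z =
        (a ^ n)⁻¹ * ∫ z in (K : Set (EuclideanSpace ℝ (Fin n))), k z := fun k => by
    rw [setAverage_eq, hvr, smul_eq_mul]
  set A := ⨍ z in (K : Set (EuclideanSpace ℝ (Fin n))), f z with hA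
  have hba : 0 < b / a := div_pos hb ha
  have hAle : b / a ≤ A := by
    rw [hA, hav, inv_mul_eq_div, le_div_iff₀ han]
    refine le_trans (le_of_eq ?_) hmink
    obtain ⟨k, rfl⟩ := Nat.exists_eq_succ_of_ne_zero hn
    simp only [Nat.succ_eq_add_one, Nat.add_sub_cancel, pow_succ]
    field_simp
  have hφA : φ (b / a) ≤ φ A := hφ.strictMonoOn.monotoneOn hba (hba.trans_le hAle) hAle
  have hIcc : Icc r R ⊆ Ioi 0 := fun x hx => hr.trans_le hx.1
  have hfR : ∀ᵐ z ∂volume.restrict (K : Set (EuclideanSpace ℝ (Fin n))), f z ∈ Icc r R :=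
    ae_restrict_of_ae hrR
  have hφint : Integrable (φ ∘ f) (volume.restrict (K : Set (EuclideanSpace ℝ (Fin n)))) := by
    classical
    have hm : Measurable (((Ioi 0).piecewise φ 0) ∘ f) :=
      (hφ.continuousOn.measurable_piecewise continuousOn_const measurableSet_Ioi).comp
        (measurable_supportFun_gradient K M)
    refine Integrable.of_bound (C := φ R) (hm.aestronglyMeasurable.congr ?_) ?_
    · filter_upwards [hfR] with z hz
      exact piecewise_eq_of_mem _ _ _ (hIcc hz)
    · filter_upwards [hfR] with z hz
      rw [Real.norm_eq_abs, Function.comp_apply, abs_of_pos (hφ.pos _ (hIcc hz))]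
      exact hφ.strictMonoOn.monotoneOn (hIcc hz) ((hIcc hz).trans_le hz.2) hz.2
  -- Strict Jensen on `[r, R]`: either `f` is almost everywhere its mean `A`, or the inequality is
  -- strict. In the first case equality forces `φ A = φ (b / a)`, so `A = b / a` by injectivity.
  rcases (hconv.subset hIcc (convex_Icc r R)).ae_eq_const_or_map_average_lt
    (hφ.continuousOn.mono hIcc) isClosed_Icc hfR hint hφint with hc | hlt
  · have hval : ∫ z in (K : Set (EuclideanSpace ℝ (Fin n))), φ (f z) = φ A * a ^ n := by
      rw [integral_congr_ae (g := fun _ => φ A) (hc.mono fun z hz => by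
        simp only [hz, Function.const_apply, hA]), setIntegral_const, hvr, smul_eq_mul, mul_comm]
    rw [hval]
    refine ⟨mul_le_mul_of_nonneg_right hφA han.le, fun heq => ?_⟩
    have hAeq : A = b / a := hφ.strictMonoOn.injOn (hba.trans_le hAle) hba
      (mul_right_cancel₀ han.ne' heq)
    refine eq_smul_of_ae_supportFun_gradient_eq hn hK hba (hc.mono fun z hz => ?_) ?_
    · rw [← hAeq]
      exact hz
    · rw [hMb, hKa, ← ENNReal.ofReal_mul (by positivity), div_pow, div_mul_cancel₀ _ han.ne']
  · have hlt' : φ (b / a) * a ^ n < ∫ z in (K : Set (EuclideanSpace ℝ (Fin n))), φ (f z) := by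
      have h1 := hφA.trans_lt hlt
      rwa [hav, inv_mul_eq_div, lt_div_iff₀ han] at h1
    exact ⟨hlt'.le, fun heq => absurd heq hlt'.ne'⟩

/-- The ratio of the support functions is constantly `c`, so the integrand is constant. -/
theorem orliczMixedVolume_smul_self
    (hn : n ≠ 0)
    (hK : (0 : EuclideanSpace ℝ (Fin n)) ∈ interior (K : Set (EuclideanSpace ℝ (Fin n))))
    {φ : ℝ → ℝ} (hφ : ContinuousOn φ (Ioi 0)) {a c : ℝ} (ha : 0 < a) (hc : 0 < c)
    (hKa : volume (K : Set (EuclideanSpace ℝ (Fin n))) = ENNReal.ofReal (a ^ n)) :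
    orliczMixedVolume φ (K : Set (EuclideanSpace ℝ (Fin n)))
      (c • K : ConvexBody (EuclideanSpace ℝ (Fin n))) = φ c * a ^ n := by
  have hcK : (0 : EuclideanSpace ℝ (Fin n)) ∈
      interior ((c • K : ConvexBody (EuclideanSpace ℝ (Fin n))) : Set _) := by
    rw [ConvexBody.coe_smul, interior_smul₀ hc.ne']
    exact ⟨0, hK, smul_zero c⟩
  rw [orliczMixedVolume_eq_integral_gradient hn hK hcK hφ,
    integral_congr_ae (g := fun _ => φ c), setIntegral_const, measureReal_def, hKa,
    ENNReal.toReal_ofReal (pow_pos ha n).le, smul_eq_mul, mul_comm]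
  filter_upwards [ae_restrict_of_ae (ae_exists_polarPoint_eq_gradient hn hK)] with z ⟨_, u, hu, _⟩
  rw [← hu, ConvexBody.coe_smul, supportFun_smul_set K hc.le, supportFun_polarPoint hK,
    div_self (supportFun_pos hK (sphere_coe_ne_zero u)).ne', mul_one]

theorem exists_volume_eq_pow
    (hn : n ≠ 0)
    (hK : (0 : EuclideanSpace ℝ (Fin n)) ∈ interior (K : Set (EuclideanSpace ℝ (Fin n)))) :
    ∃ a : ℝ, 0 < a ∧
      volume (K : Set (EuclideanSpace ℝ (Fin n))) = ENNReal.ofReal (a ^ n) := by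
  have h0 : 0 < volume (K : Set (EuclideanSpace ℝ (Fin n))) :=
    Measure.measure_pos_of_mem_nhds volume (mem_interior_iff_mem_nhds.1 hK)
  have h1 : 0 < (volume (K : Set (EuclideanSpace ℝ (Fin n)))).toReal :=
    ENNReal.toReal_pos h0.ne' (volume_body_ne_top K)
  refine ⟨_, Real.rpow_pos_of_pos h1 (n : ℝ)⁻¹, ?_⟩
  rw [Real.rpow_inv_natCast_pow h1.le hn, ENNReal.ofReal_toReal (volume_body_ne_top K)]

/-- The volumes of dilates of `K` are bounded by the Orlicz mixed volumes with `L`. -/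
theorem map_mul_le_of_orliczMixedVolume_eq {L : ConvexBody (EuclideanSpace ℝ (Fin n))}
    (hn : n ≠ 0)
    (hK : (0 : EuclideanSpace ℝ (Fin n)) ∈ interior (K : Set (EuclideanSpace ℝ (Fin n))))
    (hL : (0 : EuclideanSpace ℝ (Fin n)) ∈ interior (L : Set (EuclideanSpace ℝ (Fin n))))
    {φ : ℝ → ℝ} (hφ : ClassI φ) (hconv : StrictConvexOn ℝ (Ioi 0) φ)
    (hV : ∀ M : ConvexBody (EuclideanSpace ℝ (Fin n)),
      (0 : EuclideanSpace ℝ (Fin n)) ∈ interior (M : Set (EuclideanSpace ℝ (Fin n))) →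
        orliczMixedVolume φ (K : Set (EuclideanSpace ℝ (Fin n))) M =
          orliczMixedVolume φ (L : Set (EuclideanSpace ℝ (Fin n))) M)
    {k l c : ℝ} (hk : 0 < k) (hl : 0 < l) (hc : 0 < c)
    (hKk : volume (K : Set (EuclideanSpace ℝ (Fin n))) = ENNReal.ofReal (k ^ n))
    (hLl : volume (L : Set (EuclideanSpace ℝ (Fin n))) = ENNReal.ofReal (l ^ n)) :
    φ (c * k / l) * l ^ n ≤ φ c * k ^ n ∧ (φ c * k ^ n = φ (c * k / l) * l ^ n →
      ((c • K : ConvexBody (EuclideanSpace ℝ (Fin n))) : Set (EuclideanSpace ℝ (Fin n))) =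
        (c * k / l) • (L : Set (EuclideanSpace ℝ (Fin n)))) := by
  have hcK : (0 : EuclideanSpace ℝ (Fin n)) ∈
      interior ((c • K : ConvexBody (EuclideanSpace ℝ (Fin n))) : Set _) := by
    rw [ConvexBody.coe_smul, interior_smul₀ hc.ne']
    exact ⟨0, hK, smul_zero c⟩
  have hv : volume ((c • K : ConvexBody (EuclideanSpace ℝ (Fin n))) :
      Set (EuclideanSpace ℝ (Fin n))) =
      ENNReal.ofReal ((c * k) ^ n) := by
    rw [ConvexBody.coe_smul, Measure.addHaar_smul, finrank_euclideanSpace_fin, hKk,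
      abs_of_pos (pow_pos hc n), ← ENNReal.ofReal_mul (pow_pos hc n).le, mul_pow]
  have h := orlicz_minkowski_inequality hn hL hcK hφ hconv hl (mul_pos hc hk) hLl hv
  rwa [← hV _ hcK, orliczMixedVolume_smul_self hn hK hφ.continuousOn hk hc hKk] at h

end OrliczMinkowski

end OrliczMixed

/-! ### Determination of the body by its Orlicz mixed volumes. -/

theorem mainTheorem11 (n : ℕ) (hn : 2 ≤ n)
    (K L : ConvexBody (EuclideanSpace ℝ (Fin n)))
    (hK : (0 : EuclideanSpace ℝ (Fin n)) ∈ interior (K : Set (EuclideanSpace ℝ (Fin n))))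
    (hL : (0 : EuclideanSpace ℝ (Fin n)) ∈ interior (L : Set (EuclideanSpace ℝ (Fin n))))
    (φ : ℝ → ℝ) (hφ : OrliczMixed.ClassI φ) (hconv : StrictConvexOn ℝ (Set.Ioi 0) φ)
    (hV : ∀ M : ConvexBody (EuclideanSpace ℝ (Fin n)),
      (0 : EuclideanSpace ℝ (Fin n)) ∈ interior (M : Set (EuclideanSpace ℝ (Fin n))) →
        OrliczMixed.orliczMixedVolume φ (K : Set (EuclideanSpace ℝ (Fin n))) M =
          OrliczMixed.orliczMixedVolume φ (L : Set (EuclideanSpace ℝ (Fin n))) M) :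
    OrliczMixed.IsDilatate (K : Set (EuclideanSpace ℝ (Fin n))) L ∧
      (¬ OrliczMixed.BehavesLikePow n φ → K = L) := by
  have hn0 : n ≠ 0 := by omega
  obtain ⟨k, hk, hKk⟩ := OrliczMixed.exists_volume_eq_pow hn0 hK
  obtain ⟨l, hl, hLl⟩ := OrliczMixed.exists_volume_eq_pow hn0 hL
  have heq : ∀ c : ℝ, 0 < c → φ c * k ^ n = φ (c * k / l) * l ^ n := by
    intro c hc
    refine le_antisymm ?_ (OrliczMixed.map_mul_le_of_orliczMixedVolume_eq hn0 hK hL hφ hconv hV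
      hk hl hc hKk hLl).1
    -- The roles of `K` and `L` are exchanged, with the factor `c * k / l` for which the dilate of
    -- `L` has the volume of `c • K`.
    have h := (OrliczMixed.map_mul_le_of_orliczMixedVolume_eq hn0 hL hK hφ hconv
      (fun M hM => (hV M hM).symm) hl hk (c := c * k / l) (by positivity) hLl hKk).1
    rwa [div_mul_cancel₀ _ hl.ne', mul_div_cancel_right₀ _ hk.ne'] at h
  have hKL : (K : Set (EuclideanSpace ℝ (Fin n))) = (k / l) • (L : Set _) := by
    have h := (OrliczMixed.map_mul_le_of_orliczMixedVolume_eq hn0 hK hL hφ hconv hV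
      hk hl one_pos hKk hLl).2 (heq 1 one_pos)
    rwa [one_smul, one_mul] at h
  refine ⟨⟨l / k, div_pos hl hk, ?_⟩, fun hpow => ?_⟩
  · rw [hKL, smul_smul, div_mul_div_cancel₀ hk.ne', div_self hl.ne', one_smul]
  · by_cases hkl : k = l
    · rw [hkl, div_self hl.ne', one_smul] at hKL
      exact SetLike.coe_injective hKL
    -- Solving `heq` for `φ` at `(k / l) * t` exhibits the behaviour like `t ^ n` with ratio `k / l
    -- ≠ 1`.
    · refine absurd ⟨k / l, div_pos hk hl, ?_, fun t ht => ?_⟩ hpow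
      · rwa [Ne, div_eq_one_iff_eq hl.ne']
      · have h := heq t ht
        rw [mul_div_assoc, mul_comm t] at h
        refine mul_right_cancel₀ (pow_pos hl n).ne' (h.symm.trans ?_)
        rw [mul_right_comm, ← mul_pow, div_mul_cancel₀ _ hl.ne', mul_comm]
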